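/- Let $N\ge 2$ players have action spaces $\mathbb R^{n_i}$, $n=\sum_i n_i$, and quadratic costs $J_i(x)=\tfrac12x^TQ_ix+l_i^Tx+e_i$ with $Q_i=Q_i^T\in\mathbb R^{n\times n}$, $l_i\in\mathbb R^n$, $e_i\in\mathbb R$, where every $J_i$ is $C^1$ and, for every $x_{-i}$, convex and radially unbounded in the own action $x_i\in\mathbb R^{n_i}$. Let $F(x)=\mathrm{col}(\nabla_{x_i}J_i(x))_{i}$ be the pseudo-gradient. Let $A_i\in\mathbb R^{n_i\times n}$ consist of the rows of $Q_i$ that belong to the coordinates of player $i$, let $A\in\mathbb R^{n\times n}$ be the stack of $A_1,\dots,A_N$ (so $F(x)=Ax+b$ for a vector $b$), let $\mathbf A=\mathrm{blkdiag}(A_1,\dots,A_N)\in\mathbb R^{n\times Nn}$, and $L_{\mathbf A}=\|\mathbf A\|$. (Vector norms are Euclidean, matrix norms spectral.) Assume that $F$ is $L_F$-Lipschitz, $R$-inverse Lipschitz ($\|x-y\|\le R\|F(x)-F(y)\|$ for all $x,y$) and $\mu$-hypomonotone ($\langle F(x)-F(y),x-y\rangle\ge-\mu\|x-y\|^2$ for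 all $x,y$) for some $L_F,R,\mu\ge0$. The agents communicate over a connected undirected graph with symmetric weights $W=(w_{ij})$, $w_{ij}>0$ if $i,j$ are adjacent and $w_{ij}=0$ otherwise; $L=\mathrm{diag}(\sum_jw_{ij})_i-W$ is the Laplacian and $\lambda_2(L)$ its second smallest eigenvalue counted with multiplicity. Agent $i$ holds $\mathbf x^i,\mathbf r^i\in\mathbb R^n$, $\mathbf x^i$ being its estimate of the joint action; put $\mathbf x=\mathrm{col}(\mathbf x^i)_i$, $\mathbf r=\mathrm{col}(\mathbf r^i)_i$, $\mathbf F(\mathbf x)=\mathrm{col}(\nabla_{x_i}J_i(\mathbf x^i))_i\in\mathbb R^n$, and let $\mathcal R\in\mathbb R^{n\times Nn}$ be the matrix with $\mathcal R\mathbf x=\mathrm{col}(\mathbf x^i_i)_i$, where $\mathbf x^i_i$ is the block of $\mathbf x^i$ belonging to player $i$. The dynamics are $$\dot{\mathbf x}=-\mathcal R^T\mathbf F(\mathbf x)-\beta(\mathbf x-\mathbf r)-c\,(L\otimes I_n)\mathbf x,\qquad \dot{\mathbf r}=\alpha(\mathbf x-\mathbf r).$$ Let $\alpha=\alpha_0/N$,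 $\beta=\beta_0/N$, where $\alpha_0,\beta_0>0$ are such that for every eigenvalue $\rho=r+\mathrm jk\in\mathbb C$ of $A$ with $r<0$, $$\beta_0\in\Big(-r,\frac{k^2+r^2}{-r}\Big),\qquad \alpha_0\in\Big(0,\,-(\beta_0+r)+\sqrt{\tfrac{(\beta_0+r)k^2}{-r}}\Big).$$ Let $\tilde M=\begin{bmatrix}-\frac1NA-\beta I&\beta I\\ \alpha I&-\alpha I\end{bmatrix}$. Then: (1) $x$ is a Nash equilibrium if and only if $F(x)=0$. (2) There is a symmetric $P\succ0$ with $P\tilde M+\tilde M^TP=-I$. (3) For every such $P$, with $p=\|P\|$, and every $c>0$ with $$c\,\lambda_2(L)\ \ge\ L_{\mathbf A}+\Big(L_{\mathbf A}\big(\tfrac{p}{\sqrt N}+\tfrac12\big)\Big)^2,$$ the consensual Nash equilibrium set $\{(\mathbf 1_N\otimes x^*,\mathbf 1_N\otimes x^*):F(x^*)=0\}$ is nonempty and globally asymptotically stable for the dynamics: solutions $(\mathbf x,\mathbf r)$ exist on $[0,\infty)$ from every initial state; for every $\varepsilon>0$ there is $\delta>0$ such that every solution starting at distance less than $\delta$ from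 the set stays at distance less than $\varepsilon$ from it for all $t\ge0$; and the distance of every solution to the set tends to $0$ as $t\to\infty$. -/

import Mathlib

open scoped Matrix Kronecker Matrix.Norms.L2Operator

noncomputable section

namespace QuadGame

/-! ### Games with action sets `ℝ^(d i)` -/

/-- Coordinates of a joint action: pairs (player `i`, coordinate of the action of `i`). -/
abbrev Coord {N : ℕ} (d : Fin N → ℕ) : Type := Σ i : Fin N, Fin (d i)

/-- Joint actions `x = (x_1, …, x_N)`, with the Euclidean norm. -/
abbrev Profile {N : ℕ} (d : Fin N → ℕ) : Type := EuclideanSpace ℝ (Coord d)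

/-- Stacked vectors `(x^1, …, x^N)`: one joint-action estimate for every agent. -/
abbrev Stacked {N : ℕ} (d : Fin N → ℕ) : Type := EuclideanSpace ℝ (Fin N × Coord d)

/-- The own action `x_i`. -/
def ownAction {N : ℕ} {d : Fin N → ℕ} (x : Profile d) (i : Fin N) : EuclideanSpace ℝ (Fin (d i)) :=
  WithLp.toLp 2 fun k => x ⟨i, k⟩

/-- The profile `(y, x_{-i})`: player `i` plays `y` and all others play as in `x`. -/
def deviate {N : ℕ} {d : Fin N → ℕ} (x : Profile d) (i : Fin N) (y : EuclideanSpace ℝ (Fin (d i))) :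
    Profile d :=
  WithLp.toLp 2 fun s =>
    Function.update (fun (j : Fin N) (k : Fin (d j)) => x ⟨j, k⟩) i (fun k => y k) s.1 s.2

/-- Nash equilibrium of the game with cost functions `J i`. -/
def IsNash {N : ℕ} {d : Fin N → ℕ} (J : Fin N → Profile d → ℝ) (x : Profile d) : Prop :=
  ∀ (i : Fin N) (y : EuclideanSpace ℝ (Fin (d i))), J i x ≤ J i (deviate x i y)

/-- Every cost is `C^1`, and convex and radially unbounded in the own action. -/
structure RegularCosts {N : ℕ} {d : Fin N → ℕ} (J : Fin N → Profile d → ℝ) : Prop where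
  contDiff : ∀ i, ContDiff ℝ 1 (J i)
  convex : ∀ i (x : Profile d), ConvexOn ℝ Set.univ fun y => J i (deviate x i y)
  radiallyUnbounded : ∀ i (x : Profile d),
    Filter.Tendsto (fun y => J i (deviate x i y)) (Bornology.cobounded _) Filter.atTop

/-- The partial gradient `∇_{x_i} J_i (x)`. -/
def partialGrad {N : ℕ} {d : Fin N → ℕ} (J : Fin N → Profile d → ℝ) (i : Fin N) (x : Profile d) :
    EuclideanSpace ℝ (Fin (d i)) :=
  gradient (fun y => J i (deviate x i y)) (ownAction x i)

/-- The pseudo-gradient `F(x) = col(∇_{x_i} J_i (x))_i`. -/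
def pseudoGrad {N : ℕ} {d : Fin N → ℕ} (J : Fin N → Profile d → ℝ) (x : Profile d) : Profile d :=
  WithLp.toLp 2 fun s => partialGrad J s.1 x s.2

/-- The estimate `x^i` held by agent `i`. -/
def estimate {N : ℕ} {d : Fin N → ℕ} (X : Stacked d) (i : Fin N) : Profile d :=
  WithLp.toLp 2 fun s => X (i, s)

/-- The extended pseudo-gradient `col(∇_{x_i} J_i (x^i))_i`. -/
def extPseudoGrad {N : ℕ} {d : Fin N → ℕ} (J : Fin N → Profile d → ℝ) (X : Stacked d) : Profile d :=
  WithLp.toLp 2 fun s => partialGrad J s.1 (estimate X s.1) s.2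

/-- `μ`-hypomonotone maps, `μ ≥ 0`. -/
def Hypomonotone {E : Type*} [NormedAddCommGroup E] [InnerProductSpace ℝ E] (μ : ℝ) (T : E → E) :
    Prop :=
  0 ≤ μ ∧ ∀ x y, -μ * ‖x - y‖ ^ 2 ≤ inner ℝ (T x - T y) (x - y)

/-! ### Quadratic games -/

/-- `J_i(x) = (1/2) xᵀ Q_i x + l_iᵀ x + e_i`. -/
def quadCost {N : ℕ} {d : Fin N → ℕ} (Q : Fin N → Matrix (Coord d) (Coord d) ℝ)
    (l : Fin N → Coord d → ℝ) (e : Fin N → ℝ) (i : Fin N) (x : Profile d) : ℝ :=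
  1 / 2 * (x.ofLp ⬝ᵥ Q i *ᵥ x.ofLp) + l i ⬝ᵥ x.ofLp + e i

/-- The matrix `A` of the pseudo-gradient: its `i`-th block of rows consists of those rows of `Q_i`
that belong to the coordinates of player `i`. -/
def gameMatrix {N : ℕ} {d : Fin N → ℕ} (Q : Fin N → Matrix (Coord d) (Coord d) ℝ) :
    Matrix (Coord d) (Coord d) ℝ :=
  Matrix.of fun s t => Q s.1 s t

/-- The matrix `𝐀` of the extended pseudo-gradient, the block diagonal matrix whose `i`-th block is
the `i`-th block of rows of `A`. -/
def extGameMatrix {N : ℕ} {d : Fin N → ℕ} (Q : Fin N → Matrix (Coord d) (Coord d) ℝ) :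
    Matrix (Coord d) (Fin N × Coord d) ℝ :=
  Matrix.of fun s p => if p.1 = s.1 then gameMatrix Q s p.2 else 0

/-- Conditions on the gains `α, β` in terms of the complex eigenvalues `ρ = r + jk` of the real
matrix `A`: both are positive and, for every eigenvalue with `r < 0`,
`β ∈ (-r, (k² + r²)/(-r))` and `α ∈ (0, -(β + r) + √((β + r) k² / (-r)))`. -/
def AdmissibleGains {n : Type*} [Fintype n] [DecidableEq n] (A : Matrix n n ℝ) (α β : ℝ) : Prop :=
  0 < α ∧ 0 < β ∧
    ∀ ρ : ℂ, Module.End.HasEigenvalue (Matrix.toLin' (A.map ((↑) : ℝ → ℂ))) ρ → ρ.re < 0 →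
      β ∈ Set.Ioo (-ρ.re) ((ρ.im ^ 2 + ρ.re ^ 2) / (-ρ.re)) ∧
      α ∈ Set.Ioo 0 (-(β + ρ.re) + √((β + ρ.re) * ρ.im ^ 2 / (-ρ.re)))

/-- The matrix `M̃ = [[-(1/N) A - β I, β I], [α I, -α I]]`. -/
def scaledM {N : ℕ} {d : Fin N → ℕ} (A : Matrix (Coord d) (Coord d) ℝ) (α β : ℝ) :
    Matrix (Coord d ⊕ Coord d) (Coord d ⊕ Coord d) ℝ :=
  Matrix.fromBlocks (-((1 / (N : ℝ)) • A) - β • 1) (β • 1) (α • 1) (-(α • 1))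

/-! ### Communication graphs -/

/-- An undirected weighted graph on the agents. -/
structure CommGraph (N : ℕ) where
  graph : SimpleGraph (Fin N)
  weight : Matrix (Fin N) (Fin N) ℝ
  symm : weightᵀ = weight
  pos : ∀ i j, graph.Adj i j → 0 < weight i j
  zero : ∀ i j, ¬ graph.Adj i j → weight i j = 0

/-- The weighted Laplacian `L = Deg - W`. -/
def CommGraph.laplacian {N : ℕ} (G : CommGraph N) : Matrix (Fin N) (Fin N) ℝ :=
  Matrix.diagonal (fun i => ∑ j, G.weight i j) - G.weight

theorem CommGraph.laplacian_isHermitian {N : ℕ} (G : CommGraph N) : G.laplacian.IsHermitian := by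
  unfold Matrix.IsHermitian CommGraph.laplacian
  rw [Matrix.conjTranspose_eq_transpose_of_trivial, Matrix.transpose_sub,
    Matrix.diagonal_transpose, G.symm]

/-- `λ₂(L)`: the second smallest eigenvalue of the Laplacian, counted with multiplicity
(`eigenvalues₀` lists the eigenvalues in decreasing order). -/
def CommGraph.lambda2 {N : ℕ} (G : CommGraph N) (hN : 2 ≤ N) : ℝ :=
  G.laplacian_isHermitian.eigenvalues₀ ⟨N - 2, by rw [Fintype.card_fin]; omega⟩

/-! ### The partial-information dynamics -/

/-- The selection matrix `𝓡`, with `𝓡 X = (x^1_1, …, x^N_N)`. -/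
def selection {N : ℕ} (d : Fin N → ℕ) : Matrix (Coord d) (Fin N × Coord d) ℝ :=
  Matrix.of fun s p => if p = (s.1, s) then 1 else 0

/-- `1_N ⊗ x`. -/
def consensus {N : ℕ} {d : Fin N → ℕ} (x : Profile d) : Stacked d :=
  WithLp.toLp 2 fun p => x p.2

/-- The vector field, on states `(X, R)`, of
`X' = -𝓡ᵀ 𝐅(X) - β (X - R) - c (L ⊗ I) X`, `R' = α (X - R)`. -/
def heavyAnchorField {N : ℕ} {d : Fin N → ℕ} (J : Fin N → Profile d → ℝ)
    (L : Matrix (Fin N) (Fin N) ℝ) (α β c : ℝ) (w : Stacked d × Stacked d) :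
    Stacked d × Stacked d :=
  (-(Matrix.toEuclideanLin (selection d)ᵀ (extPseudoGrad J w.1)) - β • (w.1 - w.2)
      - c • Matrix.toEuclideanLin (L ⊗ₖ (1 : Matrix (Coord d) (Coord d) ℝ)) w.1,
    α • (w.1 - w.2))

/-- The set `{(1 ⊗ x, 1 ⊗ x) : F(x) = 0}`. -/
def consensualEquilibria {N : ℕ} {d : Fin N → ℕ} (J : Fin N → Profile d → ℝ) :
    Set (Stacked d × Stacked d) :=
  {w | ∃ x : Profile d, pseudoGrad J x = 0 ∧ w = (consensus x, consensus x)}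

/-! ### Stability -/

/-- `u` solves `u' = f(u)` on `[0, ∞)`. -/
def IsSolution {E : Type*} [NormedAddCommGroup E] [NormedSpace ℝ E] (f : E → E) (u : ℝ → E) :
    Prop :=
  ∀ t, 0 ≤ t → HasDerivWithinAt u (f (u t)) (Set.Ici 0) t

/-- Global asymptotic stability of a nonempty set `S` for `u' = f(u)`: solutions on `[0, ∞)` exist
from every initial state, `S` is Lyapunov stable, and every solution converges to `S`. -/
structure GloballyAsymptoticallyStable {E : Type*} [NormedAddCommGroup E] [NormedSpace ℝ E]
    (f : E → E) (S : Set E) : Prop where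
  nonempty : S.Nonempty
  exists_solution : ∀ u₀ : E, ∃ u : ℝ → E, u 0 = u₀ ∧ IsSolution f u
  stable : ∀ ε > 0, ∃ δ > 0, ∀ u : ℝ → E, IsSolution f u → Metric.infDist (u 0) S < δ →
    ∀ t, 0 ≤ t → Metric.infDist (u t) S < ε
  attractive : ∀ u : ℝ → E, IsSolution f u →
    Filter.Tendsto (fun t => Metric.infDist (u t) S) Filter.atTop (nhds 0)

end QuadGame

end

/-! The pseudo-gradient is the affine map `x ↦ Ax + b`. Being inverse Lipschitz, it is injective, so
`A` is nonsingular and `F` has exactly one zero `x*`. The equilibrium set is therefore a single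
point, and in coordinates centred there the dynamics are linear (`heavyAnchorField_quadCost`).
Global asymptotic stability then reduces to excluding eigenvalues with nonnegative real part
(`closedLoop_isHurwitzMap`, `IsHurwitzMap.globallyAsymptoticallyStable`). Claim (1) is the
first-order condition for convex functions.

For claim (2), an eigenvalue `s` of `M̃` makes `S = Ns` a root of `S² + (α₀ + β₀ + ρ)S + α₀ρ` for
some eigenvalue `ρ ≠ 0` of `A`. The gain conditions put these roots in the open left half plane
(`re_neg_of_quadratic`). The Cayley transform turns the Lyapunov equation for a Hurwitz matrix into
a Stein equation, solved by a convergent series.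

For claim (3), split the state into its average `z` over the agents and the disagreements `X`, `Y`
of the two components. The average obeys `M̃`, perturbed by a term linear in `X`, while the
Laplacian damps `X` at rate at least `cλ₂`. A weighted sum of `zᵀPz`, `‖X‖²` and `‖Y‖²` does not
increase along solutions (`lyapunovForm_closedLoop_le`), but its decrease need not be strict. A
linear LaSalle argument fills the gap: on an eigenvector with nonnegative real part the dissipation
must vanish, which forces `X = Y`, then `X = Y = 0`, then `z = 0`; the eigenvalue `0` is excluded by
a direct kernel computation. -/

noncomputable section

namespace QuadGame

/-! ### Lyapunov equation for Hurwitz matrices -/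

/-- All complex eigenvalues have negative real part. -/
def IsHurwitz {n : Type*} [Fintype n] (M : Matrix n n ℝ) : Prop :=
  ∀ (s : ℂ) (v : n → ℂ), v ≠ 0 → M.map ((↑) : ℝ → ℂ) *ᵥ v = s • v → s.re < 0

/-- Gelfand's formula bounds `‖a ^ k‖` by `r ^ k` for large `k`, with `r` strictly between the
spectral radius and 1. -/
theorem summable_norm_pow_of_spectralRadius_lt_one {𝔸 : Type*} [NormedRing 𝔸] [NormedAlgebra ℂ 𝔸]
    [CompleteSpace 𝔸] {a : 𝔸} (ha : spectralRadius ℂ a < 1) : Summable fun k => ‖a ^ k‖ ^ 2 := by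
  obtain ⟨r, hr₁, hr₂⟩ := ENNReal.lt_iff_exists_nnreal_btwn.1 ha
  have hr : r < 1 := by exact_mod_cast hr₂
  have hg := spectrum.pow_nnnorm_pow_one_div_tendsto_nhds_spectralRadius a
  have hev := (hg.eventually (gt_mem_nhds hr₁)).and (Filter.eventually_gt_atTop 0)
  have hs : Summable fun k => ((r : ℝ) ^ 2) ^ k :=
    summable_geometric_of_lt_one (by positivity) (by
      have : (r : ℝ) < 1 := by exact_mod_cast hr
      nlinarith [r.coe_nonneg])
  refine Summable.of_norm_bounded_eventually_nat hs ?_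
  filter_upwards [hev] with k ⟨hk, hk₀⟩
  have h1 : (‖a ^ k‖₊ : ENNReal) ≤ (r : ENNReal) ^ k := by
    have h2 := ENNReal.rpow_le_rpow hk.le (z := (k : ℝ)) (by positivity)
    rwa [← ENNReal.rpow_mul, one_div, inv_mul_cancel₀ (by positivity), ENNReal.rpow_one,
      ENNReal.rpow_natCast] at h2
  have h3 : ‖a ^ k‖ ≤ (r : ℝ) ^ k := by exact_mod_cast h1
  rw [Real.norm_of_nonneg (by positivity), ← pow_mul, mul_comm 2 k, pow_mul]
  gcongr

/-! ### The Lyapunov equation through the Cayley transform -/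

section Cayley

open scoped ComplexOrder

variable {n : Type*} [Fintype n] [DecidableEq n]

theorem isUnit_one_sub_of_re_neg {M : Matrix n n ℂ}
    (hM : ∀ (s : ℂ) (v : n → ℂ), v ≠ 0 → M *ᵥ v = s • v → s.re < 0) : IsUnit (1 - M).det := by
  rw [isUnit_iff_ne_zero]
  intro h
  obtain ⟨v, hv, h0⟩ := Matrix.exists_mulVec_eq_zero_iff.2 h
  have := hM 1 v hv (by
    rw [Matrix.sub_mulVec, Matrix.one_mulVec, sub_eq_zero] at h0
    rw [one_smul, ← h0])
  simp at this
  linarith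

/-- If `v` is an eigenvector for `z`, then `w = (1 - M)⁻¹ v` satisfies `(z + 1) M w = (z - 1) w`.
Hence `(z - 1)/(z + 1)` is an eigenvalue of `M`, and its real part `(|z|² - 1)/|z + 1|²` is negative
exactly when `|z| < 1`. -/
theorem spectralRadius_cayley_lt_one [Nonempty n] {M : Matrix n n ℂ}
    (hM : ∀ (s : ℂ) (v : n → ℂ), v ≠ 0 → M *ᵥ v = s • v → s.re < 0) :
    spectralRadius ℂ ((1 + M) * (1 - M)⁻¹) < 1 := by
  have hD := isUnit_one_sub_of_re_neg hM
  refine spectrum.spectralRadius_lt_of_forall_lt (r := 1) _ fun z hz => ?_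
  rw [spectrum.mem_iff, Matrix.isUnit_iff_isUnit_det, isUnit_iff_ne_zero, not_not] at hz
  obtain ⟨v, hv, h0⟩ := Matrix.exists_mulVec_eq_zero_iff.2 hz
  set w := (1 - M)⁻¹ *ᵥ v with hw
  have hvw : v = w - M *ᵥ w := by
    have : (1 - M) *ᵥ w = v := by
      rw [hw, Matrix.mulVec_mulVec, Matrix.mul_nonsing_inv _ hD, Matrix.one_mulVec]
    rw [← this, Matrix.sub_mulVec, Matrix.one_mulVec]
  have hw0 : w ≠ 0 := by
    intro h
    rw [h] at hvw
    simp at hvw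
    exact hv hvw
  have key : z • (w - M *ᵥ w) = w + M *ᵥ w := by
    rw [Matrix.sub_mulVec, sub_eq_zero, ← Matrix.mulVec_mulVec, ← hw, Algebra.algebraMap_eq_smul_one,
      Matrix.smul_mulVec, Matrix.one_mulVec, Matrix.add_mulVec, Matrix.one_mulVec] at h0
    rw [← hvw, h0]
  have key2 : (z + 1) • (M *ᵥ w) = (z - 1) • w := by
    rw [smul_sub] at key
    have : z • (M *ᵥ w) = z • w - w - M *ᵥ w := by
      rw [sub_sub, ← key]; abel
    rw [add_smul, this, sub_smul]; simp
  have hz1 : z + 1 ≠ 0 := by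
    intro h
    rw [h, zero_smul, eq_comm, smul_eq_zero] at key2
    rcases key2 with h2 | h2
    · have : (2 : ℂ) = 0 := by linear_combination h - h2
      norm_num at this
    · exact hw0 h2
  have h3 := hM ((z - 1) / (z + 1)) w hw0 (by
    rw [div_eq_inv_mul, mul_smul, ← key2, smul_smul, inv_mul_cancel₀ hz1, one_smul])
  have h4 : 0 < Complex.normSq (z + 1) := Complex.normSq_pos.2 hz1
  rw [Complex.div_re, ← add_div, div_neg_iff] at h3
  have h5 : (z - 1).re * (z + 1).re + (z - 1).im * (z + 1).im < 0 := by
    rcases h3 with h | h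
    · linarith [h.2]
    · exact h.1
  simp at h5
  rw [← NNReal.coe_lt_coe, coe_nnnorm, NNReal.coe_one, ← sq_lt_one_iff₀ (norm_nonneg _),
    Complex.sq_norm, Complex.normSq_apply]
  nlinarith

/-- The solution is `∑ (Cᴴ)ᵏ Q Cᵏ`. As a limit it is at first only positive semidefinite; strictness
comes from rewriting it as `Q + Cᴴ S C`. -/
theorem exists_stein_solution {C Q : Matrix n n ℂ} (hC : spectralRadius ℂ C < 1) (hQ : Q.PosDef) :
    ∃ S : Matrix n n ℂ, S.PosDef ∧ S - Cᴴ * S * C = Q := by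
  set T : ℕ → Matrix n n ℂ := fun k => (C ^ k)ᴴ * Q * C ^ k with hT
  have hsum : Summable T := by
    refine Summable.of_norm_bounded
      ((summable_norm_pow_of_spectralRadius_lt_one hC).mul_right ‖Q‖) fun k => ?_
    calc ‖T k‖ ≤ ‖(C ^ k)ᴴ‖ * ‖Q‖ * ‖C ^ k‖ :=
          (norm_mul_le _ _).trans (by gcongr; exact norm_mul_le _ _)
      _ = ‖C ^ k‖ ^ 2 * ‖Q‖ := by rw [Matrix.l2_opNorm_conjTranspose]; ring
  have hTpos : ∀ k, (T k).PosSemidef := fun k => hQ.posSemidef.conjTranspose_mul_mul_same _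
  have hH : (∑' k, T k).IsHermitian := by
    rw [Matrix.IsHermitian, Matrix.conjTranspose_tsum]
    exact tsum_congr fun k => (hTpos k).isHermitian
  have hstep : ∑' k, T k = Q + Cᴴ * (∑' k, T k) * C := by
    conv_lhs => rw [hsum.tsum_eq_zero_add]
    rw [← hsum.tsum_mul_left, ← (hsum.mul_left _).tsum_mul_right]
    congr 1
    · simp [hT]
    · refine tsum_congr fun k => ?_
      simp only [hT, pow_succ, Matrix.conjTranspose_mul, Matrix.mul_assoc]
  refine ⟨∑' k, T k, ?_, by conv_lhs => { lhs; rw [hstep] }; abel⟩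
  have hpsd : (∑' k, T k).PosSemidef := by
    refine Matrix.PosSemidef.of_dotProduct_mulVec_nonneg hH fun x => ?_
    have hx : HasSum (fun k => star x ⬝ᵥ (T k *ᵥ x)) (star x ⬝ᵥ ((∑' k, T k) *ᵥ x)) := by
      let φ : Matrix n n ℂ →+ ℂ :=
        { toFun := fun Y => star x ⬝ᵥ (Y *ᵥ x)
          map_zero' := by simp
          map_add' := fun Y Z => by simp [Matrix.add_mulVec] }
      exact hsum.hasSum.map φ (by
        show Continuous fun Y : Matrix n n ℂ => star x ⬝ᵥ (Y *ᵥ x)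
        fun_prop)
    exact hx.nonneg fun k => (hTpos k).dotProduct_mulVec_nonneg x
  rw [hstep]
  exact hQ.add_posSemidef (hpsd.conjTranspose_mul_mul_same _)

/-- With `D = 1 - M`, take the Stein equation for `(1 + M)D⁻¹` with right-hand side `2 D⁻ᴴD⁻¹` and
conjugate it by `D`. This gives `(1 - M)ᴴS(1 - M) - (1 + M)ᴴS(1 + M) = 2`, whose left side is `-2(SM
+ MᴴS)`. -/
theorem exists_lyapunov_complex [Nonempty n] {M : Matrix n n ℂ}
    (hM : ∀ (s : ℂ) (v : n → ℂ), v ≠ 0 → M *ᵥ v = s • v → s.re < 0) :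
    ∃ S : Matrix n n ℂ, S.PosDef ∧ S * M + Mᴴ * S = -1 := by
  have hD := isUnit_one_sub_of_re_neg hM
  set D := 1 - M with hDdef
  have hQ : ((2 : ℝ) • (D⁻¹ᴴ * D⁻¹)).PosDef :=
    (Matrix.PosDef.conjTranspose_mul_self D⁻¹ (Matrix.mulVec_injective_of_isUnit
      ((Matrix.isUnit_iff_isUnit_det _).2 (Matrix.isUnit_nonsing_inv_det _ hD)))).smul two_pos
  obtain ⟨S, hS, h⟩ := exists_stein_solution (spectralRadius_cayley_lt_one hM) hQ
  refine ⟨S, hS, ?_⟩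
  have h1 : D⁻¹ * D = 1 := Matrix.nonsing_inv_mul _ hD
  have h1' : Dᴴ * D⁻¹ᴴ = 1 := by rw [← Matrix.conjTranspose_mul, h1, Matrix.conjTranspose_one]
  have h2 := congrArg (fun Y => Dᴴ * Y * D) h
  simp only [Matrix.conjTranspose_mul, Matrix.mul_sub, Matrix.sub_mul] at h2
  have e1 : Dᴴ * ((D⁻¹)ᴴ * (1 + M)ᴴ * S * ((1 + M) * D⁻¹)) * D
      = (1 + M)ᴴ * S * (1 + M) := by
    calc _ = (Dᴴ * (D⁻¹)ᴴ) * ((1 + M)ᴴ * S * (1 + M)) * (D⁻¹ * D) := by noncomm_ring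
      _ = _ := by rw [h1, h1', one_mul, mul_one]
  have e2 : Dᴴ * ((2 : ℝ) • (D⁻¹ᴴ * D⁻¹)) * D = (2 : ℝ) • 1 := by
    rw [Matrix.mul_smul, Matrix.smul_mul]
    congr 1
    calc _ = (Dᴴ * (D⁻¹)ᴴ) * (D⁻¹ * D) := by noncomm_ring
      _ = _ := by rw [h1, h1', one_mul]
  rw [e1, e2, hDdef] at h2
  simp only [Matrix.conjTranspose_add, Matrix.conjTranspose_sub, Matrix.conjTranspose_one] at h2
  have h3 : (2 : ℝ) • (S * M + Mᴴ * S) = (2 : ℝ) • (-1) := by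
    rw [smul_neg, ← h2, two_smul]
    noncomm_ring
  exact smul_right_injective _ (two_ne_zero (α := ℝ)) h3

/-- A Hurwitz matrix has a positive definite solution of the Lyapunov equation. -/
theorem IsHurwitz.exists_lyapunov {M : Matrix n n ℝ} (hM : IsHurwitz M) :
    ∃ P : Matrix n n ℝ, P.PosDef ∧ P * M + Mᵀ * P = -1 := by
  rcases isEmpty_or_nonempty n with hn | hn
  · exact ⟨1, Matrix.PosDef.one, Subsingleton.elim _ _⟩
  obtain ⟨S, hS, h⟩ := exists_lyapunov_complex hM
  -- Since `M` is real, the entrywise real part of the complex equation is the same equation for `Re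
  -- S`.
  refine ⟨S.map Complex.re, Matrix.PosDef.of_dotProduct_mulVec_pos ?_ ?_, ?_⟩
  · ext i j
    have := congrFun (congrFun hS.isHermitian i) j
    simp only [Matrix.conjTranspose_apply, Matrix.map_apply, star_trivial] at this ⊢
    rw [← this]; simp
  · intro x hx
    have hxc : (fun i => (x i : ℂ)) ≠ 0 := fun h0 => hx (funext fun i => by
      simpa using congrFun h0 i)
    have := (Complex.lt_def.1 (hS.dotProduct_mulVec_pos hxc)).1
    simpa [dotProduct, Matrix.mulVec, Finset.mul_sum] using this
  · ext i j
    have := congrArg Complex.re (congrFun (congrFun h i) j)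
    simp only [Matrix.add_apply, Matrix.mul_apply, Matrix.map_apply, Matrix.conjTranspose_apply,
      Matrix.neg_apply, Matrix.one_apply, Matrix.transpose_apply] at this ⊢
    simp at this
    rw [this]
    split_ifs <;> simp

end Cayley

/-! ### The reduced dynamics are Hurwitz -/

/-- Roots `s = σ + jω` of `s² + (α + β + ρ) s + α ρ`, `ρ = r + jk`, lie in the left half plane. -/
theorem re_neg_of_quadratic {α β r k σ ω : ℝ} (hα : 0 < α) (hβ : 0 < β) (hrk : r ≠ 0 ∨ k ≠ 0)
    (hr : r < 0 → 0 < β + r ∧ (α + β + r) ^ 2 * (-r) < (β + r) * k ^ 2)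
    (h₁ : σ ^ 2 - ω ^ 2 + (α + β + r) * σ - k * ω + α * r = 0)
    (h₂ : 2 * σ * ω + (α + β + r) * ω + k * σ + α * k = 0) : σ < 0 := by
  by_contra! hσ
  have hbr : 0 < β + r := by
    rcases lt_or_ge r 0 with h | h
    · exact (hr h).1
    · linarith
  set a := α + β + r with ha
  have ha0 : 0 < a := by linarith
  set q := σ ^ 2 + a * σ with hq
  have hq0 : 0 ≤ q := by positivity
  have hlast : 0 < a ^ 2 * r + (β + r) * k ^ 2 := by
    rcases lt_trichotomy r 0 with h | h | h
    · linarith [(hr h).2]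
    · have hk : k ≠ 0 := hrk.resolve_left (fun hn => hn h)
      have : 0 < (β + r) * k ^ 2 := by positivity
      rw [h] at this ⊢
      linarith
    · positivity
  -- For `r < 0`, combine `4α(β + r) ≤ a²` (AM-GM) with the gain condition `a²(-r) < (β + r)k²`.
  have hmid : 0 ≤ a ^ 2 + 4 * α * r + k ^ 2 := by
    rcases lt_or_ge r 0 with h | h
    · have h4 : 4 * α * (β + r) ≤ a ^ 2 := by nlinarith [sq_nonneg (α - (β + r))]
      have h5 : 0 ≤ (β + r) * (4 * α * r + k ^ 2) := by
        nlinarith [(hr h).2, mul_le_mul_of_nonneg_left h4 (neg_nonneg.2 h.le)]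
      have := nonneg_of_mul_nonneg_right h5 hbr
      linarith [sq_nonneg a]
    · positivity
  have hω : (2 * σ + a) * ω = -(k * (σ + α)) := by linarith
  -- Eliminating `ω` through the imaginary part leaves a quadratic in `q ≥ 0` with nonnegative
  -- coefficients and positive constant term, which cannot vanish.
  have key : 4 * q ^ 2 + (a ^ 2 + 4 * α * r + k ^ 2) * q + α * (a ^ 2 * r + (β + r) * k ^ 2) = 0 := by
    have e : (2 * σ + a) ^ 2 * (σ ^ 2 - ω ^ 2 + a * σ - k * ω + α * r) =
      (2 * σ + a) ^ 2 * (σ ^ 2 + a * σ + α * r) - ((2 * σ + a) * ω) ^ 2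
        - k * (2 * σ + a) * ((2 * σ + a) * ω) := by ring
    rw [h₁, hω] at e
    have hb : β + r = a - α := by rw [ha]; ring
    rw [hq, hb]
    linear_combination -e
  have : 0 < α * (a ^ 2 * r + (β + r) * k ^ 2) := by positivity
  have : 0 ≤ (a ^ 2 + 4 * α * r + k ^ 2) * q := by positivity
  nlinarith [sq_nonneg q]

theorem sq_mul_lt_of_lt_sqrt {α β r k : ℝ} (hr : r < 0) (hα : 0 < α) (hβ : 0 < β + r)
    (h : α < -(β + r) + √((β + r) * k ^ 2 / (-r))) :
    (α + β + r) ^ 2 * (-r) < (β + r) * k ^ 2 := by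
  have h1 : α + β + r < √((β + r) * k ^ 2 / (-r)) := by linarith
  rw [Real.lt_sqrt (by linarith), lt_div_iff₀ (by linarith)] at h1
  exact h1

theorem det_ne_zero_map_ofReal {n : Type*} [Fintype n] [DecidableEq n] {A : Matrix n n ℝ}
    (hA : A.det ≠ 0) {v : n → ℂ} (hv : A.map ((↑) : ℝ → ℂ) *ᵥ v = 0) : v = 0 := by
  refine Matrix.eq_zero_of_mulVec_eq_zero ?_ hv
  have := RingHom.map_det Complex.ofRealHom A
  rw [RingHom.mapMatrix_apply] at this
  change _ = (A.map ((↑) : ℝ → ℂ)).det at this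
  rw [← this]
  simpa using hA

theorem scaledM_isHurwitz {N : ℕ} (hN : 0 < N) {d : Fin N → ℕ}
    {A : Matrix (Coord d) (Coord d) ℝ} (hA : A.det ≠ 0) {α₀ β₀ : ℝ}
    (hg : AdmissibleGains A α₀ β₀) : IsHurwitz (scaledM A (α₀ / N) (β₀ / N)) := by
  obtain ⟨hα, hβ, hev⟩ := hg
  have hNR : (0 : ℝ) < N := by exact_mod_cast hN
  have hNC : (N : ℂ) ≠ 0 := by exact_mod_cast hN.ne'
  intro s v hv hs
  set v₁ : Coord d → ℂ := fun i => v (Sum.inl i) with hv₁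
  set v₂ : Coord d → ℂ := fun i => v (Sum.inr i) with hv₂
  have hblock : (scaledM A (α₀ / N) (β₀ / N)).map ((↑) : ℝ → ℂ) = Matrix.fromBlocks
      (-((1 / (N : ℂ)) • A.map ((↑) : ℝ → ℂ)) - (β₀ / N : ℂ) • 1) ((β₀ / N : ℂ) • 1)
      ((α₀ / N : ℂ) • 1) (-((α₀ / N : ℂ) • 1)) := by
    ext (i | i) (j | j) <;> simp [scaledM, Matrix.one_apply] <;> split_ifs <;> simp
  have hvs : v = Sum.elim v₁ v₂ := by ext (i | i) <;> rfl
  rw [hblock, hvs, Matrix.fromBlocks_mulVec] at hs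
  have e₁ : ∀ i, (A.map ((↑) : ℝ → ℂ) *ᵥ v₁) i = -(N * s) * v₁ i - β₀ * v₁ i + β₀ * v₂ i := by
    intro i
    have := congrFun hs (Sum.inl i)
    simp [Matrix.sub_mulVec, Matrix.neg_mulVec, Matrix.smul_mulVec] at this
    field_simp at this
    linear_combination -this
  have e₂ : ∀ i, (N * s + α₀) * v₂ i = α₀ * v₁ i := by
    intro i
    have := congrFun hs (Sum.inr i)
    simp [Matrix.neg_mulVec, Matrix.smul_mulVec] at this
    field_simp at this
    linear_combination -this
  have hβC : (β₀ : ℂ) ≠ 0 := by exact_mod_cast hβ.ne'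
  have hαC : (α₀ : ℂ) ≠ 0 := by exact_mod_cast hα.ne'
  have hv₁0 : v₁ ≠ 0 := by
    intro h
    apply hv
    have h2 : v₂ = 0 := by
      funext i
      have := e₁ i
      rw [h] at this
      simpa [hβC] using this
    rw [hvs, h, h2]
    ext (i | i) <;> rfl
  have hs0 : (N * s + α₀ : ℂ) ≠ 0 := by
    intro h
    apply hv₁0
    funext i
    have := e₂ i
    rw [h] at this
    simpa [hαC] using this.symm
  -- The second block row gives `v₂ = α₀ v₁ / (Ns + α₀)`; substituting it into the first makes `v₁`
  -- an eigenvector of `A` for this `ρ`.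
  set ρ : ℂ := -(N * s) - β₀ + β₀ * α₀ / (N * s + α₀) with hρ
  have hAv : A.map ((↑) : ℝ → ℂ) *ᵥ v₁ = ρ • v₁ := by
    funext i
    have h2 : v₂ i = α₀ * v₁ i / (N * s + α₀) := by
      rw [eq_div_iff hs0, ← e₂ i]; ring
    rw [e₁ i, h2, Pi.smul_apply, smul_eq_mul, hρ]
    ring
  have hρ0 : ρ ≠ 0 := by
    intro h
    rw [h, zero_smul] at hAv
    exact hv₁0 (det_ne_zero_map_ofReal hA hAv)
  have heig : Module.End.HasEigenvalue (Matrix.toLin' (A.map ((↑) : ℝ → ℂ))) ρ :=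
    Module.End.hasEigenvalue_of_hasEigenvector (x := v₁)
      ⟨Module.End.mem_eigenspace_iff.2 (by rw [Matrix.toLin'_apply, hAv]), hv₁0⟩
  have hquad : (N * s) ^ 2 + (α₀ + β₀ + ρ) * (N * s) + α₀ * ρ = 0 := by
    have : ρ * (N * s + α₀) = (-(N * s) - β₀) * (N * s + α₀) + β₀ * α₀ := by
      rw [hρ, add_mul, div_mul_cancel₀ _ hs0]
    linear_combination this
  have hre := congrArg Complex.re hquad
  have him := congrArg Complex.im hquad
  simp [pow_two] at hre him
  have := re_neg_of_quadratic (σ := N * s.re) (ω := N * s.im) (r := ρ.re) (k := ρ.im) hα hβ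
    (by
      by_contra! h
      exact hρ0 (Complex.ext h.1 h.2))
    (fun hr => by
      obtain ⟨hb, ha⟩ := hev ρ heig hr
      have hb' : 0 < β₀ + ρ.re := by linarith [hb.1]
      exact ⟨hb', sq_mul_lt_of_lt_sqrt hr hα hb' ha.2⟩)
    (by linear_combination hre) (by linear_combination him)
  by_contra! h
  exact absurd this (not_lt.2 (by positivity))

/-! ### Pseudo-gradients of quadratic games -/

section PseudoGradient

variable {N : ℕ} {d : Fin N → ℕ}

@[simp] theorem deviate_ownAction (x : Profile d) (i : Fin N) : deviate x i (ownAction x i) = x := by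
  ext ⟨j, k⟩
  by_cases h : j = i
  · subst h; simp [deviate, ownAction]
  · simp [deviate, h]

/-- The embedding of the actions of player `i` into the joint actions. -/
def actionEmbedding (d : Fin N → ℕ) (i : Fin N) : EuclideanSpace ℝ (Fin (d i)) →ₗ[ℝ] Profile d where
  toFun y := deviate 0 i y
  map_add' y z := by
    ext ⟨j, k⟩
    by_cases h : j = i
    · subst h; simp [deviate]
    · simp [deviate, h]
  map_smul' c y := by
    ext ⟨j, k⟩
    by_cases h : j = i
    · subst h; simp [deviate]
    · simp [deviate, h]

theorem deviate_eq_add (x : Profile d) (i : Fin N) (y : EuclideanSpace ℝ (Fin (d i))) :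
    deviate x i y = actionEmbedding d i y + deviate x i 0 := by
  ext ⟨j, k⟩
  by_cases h : j = i
  · subst h; simp [deviate, actionEmbedding]
  · simp [deviate, actionEmbedding, h]

/-- The adjoint of the embedding is `ownAction`; this identifies a partial gradient as the own block
of a full gradient. -/
theorem actionEmbedding_inner (i : Fin N) (y : EuclideanSpace ℝ (Fin (d i))) (z : Profile d) :
    inner ℝ z (actionEmbedding d i y) = inner ℝ (ownAction z i) y := by
  simp only [PiLp.inner_apply, Fintype.sum_sigma]
  rw [Finset.sum_eq_single i]
  · simp [actionEmbedding, deviate, ownAction]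
  · intro j _ hj
    simp [actionEmbedding, deviate, hj]
  · simp

theorem quadCost_eq_inner (Q : Fin N → Matrix (Coord d) (Coord d) ℝ)
    (l : Fin N → Coord d → ℝ) (e : Fin N → ℝ) (i : Fin N) (x : Profile d) :
    quadCost Q l e i x = 1 / 2 * inner ℝ x (Matrix.toEuclideanCLM (n := Coord d) (𝕜 := ℝ) (Q i) x)
      + inner ℝ (WithLp.toLp 2 (l i)) x + e i := by
  simp only [quadCost, EuclideanSpace.inner_eq_star_dotProduct, star_trivial,
    Matrix.ofLp_toEuclideanCLM]
  rw [dotProduct_comm _ (l i), dotProduct_comm x.ofLp]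

theorem hasGradientAt_quadCost_deviate {Q : Fin N → Matrix (Coord d) (Coord d) ℝ}
    (hQ : ∀ i, (Q i)ᵀ = Q i) (l : Fin N → Coord d → ℝ) (e : Fin N → ℝ) (i : Fin N) (x : Profile d) :
    HasGradientAt (fun y => quadCost Q l e i (deviate x i y))
      (ownAction (Matrix.toEuclideanLin (Q i) x + WithLp.toLp 2 (l i)) i) (ownAction x i) := by
  set T := Matrix.toEuclideanCLM (n := Coord d) (𝕜 := ℝ) (Q i) with hT
  have hsymm : ∀ x y : Profile d, inner ℝ x (T y) = inner ℝ (T x) y := by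
    intro x y
    simp only [EuclideanSpace.inner_eq_star_dotProduct, star_trivial, hT, Matrix.ofLp_toEuclideanCLM]
    rw [Matrix.dotProduct_mulVec, ← Matrix.mulVec_transpose, hQ, dotProduct_comm]
  have h1 : HasFDerivAt (fun y => deviate x i y)
      (LinearMap.toContinuousLinearMap (actionEmbedding d i)) (ownAction x i) := by
    rw [show (fun y => deviate x i y) = fun y => actionEmbedding d i y + deviate x i 0 from
      funext (deviate_eq_add x i)]
    exact (LinearMap.toContinuousLinearMap (actionEmbedding d i)).hasFDerivAt.add_const _
  rw [hasGradientAt_iff_hasFDerivAt]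
  have h2 := h1.inner ℝ (T.hasFDerivAt.comp _ h1)
  have h3 := ((h2.const_mul (1 / 2)).add
    ((hasFDerivAt_const (WithLp.toLp 2 (l i)) (ownAction x i)).inner ℝ h1)).add_const (e i)
  refine (h3.congr_of_eventuallyEq (Filter.Eventually.of_forall fun y => ?_)).congr_fderiv ?_
  · exact quadCost_eq_inner Q l e i _
  · ext y
    rw [InnerProductSpace.toDual_apply_apply, ← actionEmbedding_inner, inner_add_left]
    have h4 := hsymm x (actionEmbedding d i y)
    have h5 := real_inner_comm (T x) (actionEmbedding d i y)
    change _ = inner ℝ (T x) (actionEmbedding d i y) + _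
    simp [fderivInnerCLM_apply, deviate_ownAction]
    linarith

/-- The constant term of the pseudo-gradient. -/
def gameVector (l : Fin N → Coord d → ℝ) : Profile d :=
  WithLp.toLp 2 fun s => l s.1 s

theorem partialGrad_quadCost {Q : Fin N → Matrix (Coord d) (Coord d) ℝ}
    (hQ : ∀ i, (Q i)ᵀ = Q i) (l : Fin N → Coord d → ℝ) (e : Fin N → ℝ) (i : Fin N) (x : Profile d) :
    partialGrad (quadCost Q l e) i x =
      ownAction (Matrix.toEuclideanLin (Q i) x + WithLp.toLp 2 (l i)) i :=
  (hasGradientAt_quadCost_deviate hQ l e i x).gradient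

theorem pseudoGrad_quadCost {Q : Fin N → Matrix (Coord d) (Coord d) ℝ}
    (hQ : ∀ i, (Q i)ᵀ = Q i) (l : Fin N → Coord d → ℝ) (e : Fin N → ℝ) (x : Profile d) :
    pseudoGrad (quadCost Q l e) x = Matrix.toEuclideanLin (gameMatrix Q) x + gameVector l := by
  ext s
  simp [pseudoGrad, partialGrad_quadCost hQ, ownAction, gameVector, gameMatrix, Matrix.mulVec,
    dotProduct]

theorem extPseudoGrad_quadCost {Q : Fin N → Matrix (Coord d) (Coord d) ℝ}
    (hQ : ∀ i, (Q i)ᵀ = Q i) (l : Fin N → Coord d → ℝ) (e : Fin N → ℝ) (X : Stacked d) :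
    extPseudoGrad (quadCost Q l e) X =
      Matrix.toEuclideanLin (extGameMatrix Q) X + gameVector l := by
  ext s
  simp only [extPseudoGrad, partialGrad_quadCost hQ, ownAction, gameVector, extGameMatrix,
    gameMatrix, Matrix.mulVec, dotProduct, Matrix.ofLp_toLpLin, Matrix.toLin'_apply,
    PiLp.add_apply, estimate, Matrix.of_apply, Fintype.sum_prod_type, ite_mul, zero_mul]
  rw [Finset.sum_eq_single s.1]
  · simp
  · intro j _ hj
    simp [hj]
  · simp

theorem isNash_quadCost_iff {Q : Fin N → Matrix (Coord d) (Coord d) ℝ}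
    (hQ : ∀ i, (Q i)ᵀ = Q i) {l : Fin N → Coord d → ℝ} {e : Fin N → ℝ}
    (hJ : RegularCosts (quadCost Q l e)) (x : Profile d) :
    IsNash (quadCost Q l e) x ↔ pseudoGrad (quadCost Q l e) x = 0 := by
  have hF : pseudoGrad (quadCost Q l e) x = 0 ↔ ∀ i, partialGrad (quadCost Q l e) i x = 0 := by
    constructor
    · intro h i
      ext k
      exact congrFun (congrArg WithLp.ofLp h) ⟨i, k⟩
    · intro h
      ext ⟨i, k⟩
      exact congrFun (congrArg WithLp.ofLp (h i)) k
  rw [hF]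
  refine forall_congr' fun i => ?_
  have hg := hasGradientAt_quadCost_deviate hQ l e i x
  rw [← partialGrad_quadCost hQ] at hg
  constructor
  · intro h
    have hmin : IsLocalMin (fun y => quadCost Q l e i (deviate x i y)) (ownAction x i) :=
      Filter.Eventually.of_forall fun y => by simpa using h y
    have := hmin.hasFDerivAt_eq_zero hg.hasFDerivAt
    exact (LinearIsometryEquiv.map_eq_zero_iff _).1 this
  · intro h y
    -- Along the segment to `y` the cost is convex with zero derivative at the start, so it lies
    -- above its horizontal tangent.
    set φ : ℝ → ℝ := fun t => quadCost Q l e i (deviate x i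
      (AffineMap.lineMap (ownAction x i) y t)) with hφ
    have hconv : ConvexOn ℝ Set.univ φ := by
      have := (hJ.convex i x).comp_affineMap (AffineMap.lineMap (k := ℝ) (ownAction x i) y)
      rwa [Set.preimage_univ] at this
    have hd : HasDerivAt φ 0 0 := by
      have h0 : AffineMap.lineMap (k := ℝ) (ownAction x i) y (0 : ℝ) = ownAction x i := by simp
      have h1 := hg.hasFDerivAt
      rw [h, map_zero, ← h0] at h1
      have h2 := h1.comp_hasDerivAt (0 : ℝ) (AffineMap.hasDerivAt_lineMap (𝕜 := ℝ))
      rwa [zero_apply] at h2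
    have hle : φ 0 ≤ φ 1 := by
      have := hconv.le_slope_of_hasDerivAt (Set.mem_univ 0) (Set.mem_univ 1) one_pos hd
      simpa [slope] using this
    simpa [hφ] using hle

end PseudoGradient

/-! ### Exponential decay of linear systems -/

theorem exists_pos_mul_sq_le_of_posDef {n : Type*} [Fintype n] [DecidableEq n] {P : Matrix n n ℝ}
    (hP : P.PosDef) :
    ∃ m > 0, ∀ x : EuclideanSpace ℝ n, m * ‖x‖ ^ 2 ≤ inner ℝ x (Matrix.toEuclideanLin P x) := by
  have hpos : ∀ x : EuclideanSpace ℝ n, x ≠ 0 → 0 < inner ℝ x (Matrix.toEuclideanLin P x) := by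
    intro x hx
    have := hP.dotProduct_mulVec_pos (x := x.ofLp) (by simpa using hx)
    rwa [EuclideanSpace.inner_eq_star_dotProduct, dotProduct_comm]
  -- An empty unit sphere means a trivial space. Otherwise `m` is the minimum of the form on the
  -- compact sphere.
  rcases (Metric.sphere (0 : EuclideanSpace ℝ n) 1).eq_empty_or_nonempty with h | h
  · refine ⟨1, one_pos, fun x => ?_⟩
    have hx : x = 0 := by
      by_contra hx
      have : (‖x‖⁻¹ • x) ∈ Metric.sphere (0 : EuclideanSpace ℝ n) 1 := by
        simp [norm_smul, hx]
      rw [h] at this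
      exact this
    simp [hx]
  have hcont : Continuous fun x : EuclideanSpace ℝ n => inner ℝ x (Matrix.toEuclideanLin P x) :=
    continuous_id.inner (LinearMap.continuous_of_finiteDimensional _)
  obtain ⟨x₀, hx₀, hmin⟩ := (isCompact_sphere _ _).exists_isMinOn h hcont.continuousOn
  refine ⟨_, hpos x₀ (by rintro rfl; simp at hx₀), fun x => ?_⟩
  rcases eq_or_ne x 0 with rfl | hx
  · simp
  have hn : 0 < ‖x‖ := norm_pos_iff.2 hx
  have := hmin (show (‖x‖⁻¹ • x) ∈ Metric.sphere (0 : EuclideanSpace ℝ n) 1 by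
    simp [norm_smul, hx])
  simp only [Set.mem_ofPred_eq, map_smul, inner_smul_left, inner_smul_right, RCLike.conj_to_real] at this
  rw [← mul_assoc, ← mul_inv, inv_mul_eq_div, le_div_iff₀ (by positivity)] at this
  rwa [pow_two]

theorem inner_add_inner_of_lyapunov {n : Type*} [Fintype n] [DecidableEq n] {P M : Matrix n n ℝ}
    (h : P * M + Mᵀ * P = -1) (x : EuclideanSpace ℝ n) :
    inner ℝ x (Matrix.toEuclideanLin P (Matrix.toEuclideanLin M x))
      + inner ℝ (Matrix.toEuclideanLin M x) (Matrix.toEuclideanLin P x) = -‖x‖ ^ 2 := by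
  have := congrArg (fun Y => x.ofLp ⬝ᵥ (Y *ᵥ x.ofLp)) h
  simp only [Matrix.add_mulVec, dotProduct_add, ← Matrix.mulVec_mulVec, Matrix.neg_mulVec,
    Matrix.one_mulVec, dotProduct_neg] at this
  rw [Matrix.dotProduct_mulVec x.ofLp Mᵀ, Matrix.vecMul_transpose] at this
  rw [EuclideanSpace.inner_eq_star_dotProduct, EuclideanSpace.inner_eq_star_dotProduct,
    ← real_inner_self_eq_norm_sq, EuclideanSpace.inner_eq_star_dotProduct]
  simp only [star_trivial, Matrix.ofLp_toLpLin, Matrix.toLin'_apply]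
  rw [← this, dotProduct_comm _ x.ofLp, dotProduct_comm _ (M *ᵥ x.ofLp)]

/-- Solutions of `v' = M v` decay exponentially when `M` is Hurwitz. -/
theorem IsHurwitz.exists_decay {n : Type*} [Fintype n] [DecidableEq n] {M : Matrix n n ℝ}
    (hM : IsHurwitz M) :
    ∃ K > 0, ∃ γ > 0, ∀ v : ℝ → EuclideanSpace ℝ n, IsSolution (Matrix.toEuclideanLin M) v →
      ∀ t, 0 ≤ t → ‖v t‖ ≤ K * Real.exp (-γ * t) * ‖v 0‖ := by
  obtain ⟨P, hP, hL⟩ := hM.exists_lyapunov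
  obtain ⟨m, hm, hmP⟩ := exists_pos_mul_sq_le_of_posDef hP
  -- The `+ 1` keeps `p` positive even when the space is trivial.
  set p := ‖P‖ + 1 with hp
  have hp0 : 0 < p := by positivity
  have hup : ∀ x : EuclideanSpace ℝ n, inner ℝ x (Matrix.toEuclideanLin P x) ≤ p * ‖x‖ ^ 2 := by
    intro x
    calc inner ℝ x (Matrix.toEuclideanLin P x) ≤ ‖x‖ * ‖Matrix.toEuclideanLin P x‖ :=
          real_inner_le_norm _ _
      _ ≤ ‖x‖ * (‖P‖ * ‖x‖) := by
          gcongr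
          exact Matrix.l2_opNorm_mulVec P x
      _ ≤ p * ‖x‖ ^ 2 := by rw [hp]; nlinarith [sq_nonneg ‖x‖]
  -- From `m‖v‖² ≤ V ≤ p‖v‖²` and `V' = -‖v‖² ≤ -V/p`, the function `exp(t/p) V` is nonincreasing;
  -- square roots give these constants.
  refine ⟨√(p / m), by positivity, 1 / (2 * p), by positivity, fun v hv t ht => ?_⟩
  set V : ℝ → ℝ := fun t => inner ℝ (v t) (Matrix.toEuclideanLin P (v t)) with hV
  have hVd : ∀ t, 0 ≤ t → HasDerivWithinAt V (-‖v t‖ ^ 2) (Set.Ici 0) t := by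
    intro t ht
    have h1 := ((Matrix.toEuclideanCLM (n := n) (𝕜 := ℝ) P).hasFDerivAt (x := v t)).comp_hasDerivWithinAt
      t (hv t ht)
    have h2 := (hv t ht).inner ℝ h1
    rw [← inner_add_inner_of_lyapunov hL]
    exact h2
  have hant : AntitoneOn (fun t => Real.exp (t / p) * V t) (Set.Ici 0) := by
    have hd : ∀ t, 0 ≤ t → HasDerivWithinAt (fun t => Real.exp (t / p) * V t)
        (Real.exp (t / p) * (1 / p) * V t + Real.exp (t / p) * (-‖v t‖ ^ 2)) (Set.Ici 0) t :=
      fun t ht => (((hasDerivAt_id t).div_const p).exp.hasDerivWithinAt).mul (hVd t ht)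
    refine antitoneOn_of_hasDerivWithinAt_nonpos (convex_Ici 0)
      (fun t ht => (hd t ht).continuousWithinAt)
      (fun t ht => (hd t (interior_subset ht)).mono interior_subset) fun t _ => ?_
    have : 1 / p * V t ≤ ‖v t‖ ^ 2 := by
      rw [one_div, inv_mul_le_iff₀ hp0]
      exact hup _
    nlinarith [Real.exp_pos (t / p)]
  have h1 := hant (Set.mem_Ici.2 le_rfl) (Set.mem_Ici.2 ht) ht
  simp only [zero_div, Real.exp_zero, one_mul] at h1
  refine abs_le_of_sq_le_sq' ?_ (by positivity) |>.2
  rw [mul_pow, mul_pow, Real.sq_sqrt (by positivity), ← Real.exp_nat_mul,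
    show ((2 : ℕ) : ℝ) * (-(1 / (2 * p)) * t) = -(t / p) by field_simp; simp, Real.exp_neg]
  have h2 : Real.exp (t / p) * (m * ‖v t‖ ^ 2) ≤ p * ‖v 0‖ ^ 2 :=
    (mul_le_mul_of_nonneg_left (hmP (v t)) (Real.exp_pos _).le).trans (h1.trans (hup _))
  have := Real.exp_pos (t / p)
  field_simp
  linarith

/-- A real linear map is Hurwitz when it has no eigenvector `x + jy` of its complexification for an
eigenvalue `σ + jω` with `0 ≤ σ`. -/
def IsHurwitzMap {E : Type*} [AddCommGroup E] [Module ℝ E] (T : E →ₗ[ℝ] E) : Prop :=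
  ∀ (σ ω : ℝ) (x y : E), 0 ≤ σ → T x = σ • x - ω • y → T y = ω • x + σ • y → x = 0 ∧ y = 0

/-- Real and imaginary parts of a complex eigenvector of the matrix form the pair excluded by
`IsHurwitzMap`, so the product state space never has to be complexified. -/
theorem IsHurwitzMap.toMatrix {E : Type*} [AddCommGroup E] [Module ℝ E] {n : Type*} [Fintype n]
    [DecidableEq n] {T : E →ₗ[ℝ] E} (hT : IsHurwitzMap T) (b : Module.Basis n ℝ E) :
    IsHurwitz (LinearMap.toMatrix b b T) := by
  intro s v hv hs
  by_contra! hσ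
  have hmul : ∀ w : n → ℝ, T (b.equivFun.symm w) = b.equivFun.symm (LinearMap.toMatrix b b T *ᵥ w) := by
    intro w
    apply b.equivFun.injective
    rw [LinearEquiv.apply_symm_apply]
    have := LinearMap.toMatrix_mulVec_repr b b T (b.equivFun.symm w)
    rw [← Module.Basis.equivFun_apply, ← Module.Basis.equivFun_apply, LinearEquiv.apply_symm_apply] at this
    exact this.symm
  have hre : LinearMap.toMatrix b b T *ᵥ (fun i => (v i).re)
      = s.re • (fun i => (v i).re) - s.im • (fun i => (v i).im) := by
    funext i
    have := congrArg Complex.re (congrFun hs i)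
    simpa [Matrix.mulVec, dotProduct] using this
  have him : LinearMap.toMatrix b b T *ᵥ (fun i => (v i).im)
      = s.im • (fun i => (v i).re) + s.re • (fun i => (v i).im) := by
    funext i
    have := congrArg Complex.im (congrFun hs i)
    simp [Matrix.mulVec, dotProduct] at this
    simp [Matrix.mulVec, dotProduct, this, add_comm]
  obtain ⟨h1, h2⟩ := hT s.re s.im (b.equivFun.symm fun i => (v i).re)
    (b.equivFun.symm fun i => (v i).im) hσ
    (by rw [hmul, hre, map_sub, map_smul, map_smul]) (by rw [hmul, him, map_add, map_smul, map_smul])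
  rw [LinearEquiv.map_eq_zero_iff] at h1 h2
  exact hv (funext fun i => Complex.ext (congrFun h1 i) (congrFun h2 i))

/-- Solutions of `u' = T u` decay exponentially when `T` is Hurwitz. -/
theorem IsHurwitzMap.exists_decay {E : Type*} [NormedAddCommGroup E] [NormedSpace ℝ E]
    [FiniteDimensional ℝ E] {T : E →L[ℝ] E} (hT : IsHurwitzMap (T : E →ₗ[ℝ] E)) :
    ∃ K > 0, ∃ γ > 0, ∀ u : ℝ → E, IsSolution T u →
      ∀ t, 0 ≤ t → ‖u t‖ ≤ K * Real.exp (-γ * t) * ‖u 0‖ := by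
  set b := Module.finBasis ℝ E
  set M := LinearMap.toMatrix b b (T : E →ₗ[ℝ] E) with hMdef
  obtain ⟨K, hK, γ, hγ, h⟩ := (hT.toMatrix b).exists_decay
  let Φ : E ≃L[ℝ] EuclideanSpace ℝ (Fin (Module.finrank ℝ E)) :=
    (b.equivFun.trans (WithLp.linearEquiv 2 ℝ _).symm).toContinuousLinearEquiv
  have hΦ : ∀ x, Φ (T x) = Matrix.toEuclideanLin M (Φ x) := by
    intro x
    have := LinearMap.toMatrix_mulVec_repr b b (T : E →ₗ[ℝ] E) x
    ext i
    exact (congrFun this i).symm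
  let Ψ : E →L[ℝ] EuclideanSpace ℝ (Fin (Module.finrank ℝ E)) := Φ
  let Ψ' : EuclideanSpace ℝ (Fin (Module.finrank ℝ E)) →L[ℝ] E := Φ.symm
  set C₁ := ‖Ψ‖
  set C₂ := ‖Ψ'‖
  refine ⟨C₂ * K * C₁ + 1, by positivity, γ, hγ, fun u hu t ht => ?_⟩
  have hsol : IsSolution (Matrix.toEuclideanLin M) (fun t => Φ (u t)) := by
    intro t ht
    rw [← hΦ]
    exact Ψ.hasFDerivAt.comp_hasDerivWithinAt t (hu t ht)
  have h0 : ‖Φ (u 0)‖ ≤ C₁ * ‖u 0‖ := Ψ.le_opNorm _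
  calc ‖u t‖ = ‖Φ.symm (Φ (u t))‖ := by rw [Φ.symm_apply_apply]
    _ ≤ C₂ * ‖Φ (u t)‖ := Ψ'.le_opNorm _
    _ ≤ C₂ * (K * Real.exp (-γ * t) * (C₁ * ‖u 0‖)) := by
        gcongr
        exact (h _ hsol t ht).trans (by gcongr)
    _ = C₂ * K * C₁ * (Real.exp (-γ * t) * ‖u 0‖) := by ring
    _ ≤ (C₂ * K * C₁ + 1) * (Real.exp (-γ * t) * ‖u 0‖) := by gcongr; linarith
    _ = _ := by ring

/-- The affine system `u' = T (u - w)` with a Hurwitz `T` is globally asymptotically stable. -/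
theorem IsHurwitzMap.globallyAsymptoticallyStable {E : Type*} [NormedAddCommGroup E]
    [NormedSpace ℝ E] [FiniteDimensional ℝ E] {T : E →L[ℝ] E}
    (hT : IsHurwitzMap (T : E →ₗ[ℝ] E)) (w : E) :
    GloballyAsymptoticallyStable (fun u => T (u - w)) {w} := by
  have : CompleteSpace E := FiniteDimensional.complete ℝ E
  obtain ⟨K, hK, γ, hγ, hdecay⟩ := hT.exists_decay
  have hdist : ∀ u : ℝ → E, IsSolution (fun u => T (u - w)) u → ∀ t, 0 ≤ t →
      Metric.infDist (u t) {w} ≤ K * Real.exp (-γ * t) * Metric.infDist (u 0) {w} := by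
    intro u hu t ht
    rw [Metric.infDist_singleton, Metric.infDist_singleton, dist_eq_norm, dist_eq_norm]
    exact hdecay (fun t => u t - w) (fun t ht => (hu t ht).sub_const w) t ht
  refine ⟨Set.singleton_nonempty w, fun u₀ => ?_, fun ε hε => ?_, fun u hu => ?_⟩
  · refine ⟨fun t => NormedSpace.exp (t • T) (u₀ - w) + w, by simp, fun t _ => ?_⟩
    have h1 := hasDerivAt_exp_smul_const' (𝕂 := ℝ) T t
    have h2 := ((ContinuousLinearMap.apply ℝ E (u₀ - w)).hasFDerivAt.comp_hasDerivAt t h1).add_const w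
    simpa using h2.hasDerivWithinAt
  · refine ⟨ε / K, by positivity, fun u hu h0 t ht => (hdist u hu t ht).trans_lt ?_⟩
    have h1 : Real.exp (-γ * t) ≤ 1 := Real.exp_le_one_iff.2 (by nlinarith)
    rw [lt_div_iff₀ hK] at h0
    have h2 : 0 ≤ K * Metric.infDist (u 0) {w} := mul_nonneg hK.le Metric.infDist_nonneg
    nlinarith
  · have hexp : Filter.Tendsto (fun t : ℝ => Real.exp (-γ * t)) Filter.atTop (nhds 0) :=
      Real.tendsto_exp_atBot.comp (Filter.tendsto_id.const_mul_atTop_of_neg (by linarith))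
    have hlim := (hexp.const_mul K).mul_const (Metric.infDist (u 0) {w})
    rw [mul_zero, zero_mul] at hlim
    refine squeeze_zero' (Filter.Eventually.of_forall fun t => Metric.infDist_nonneg) ?_ hlim
    filter_upwards [Filter.eventually_ge_atTop 0] with t ht using hdist u hu t ht

/-! ### The weighted Laplacian -/

namespace CommGraph

variable {N : ℕ} (G : CommGraph N)

theorem weight_comm (i j : Fin N) : G.weight i j = G.weight j i :=
  congrFun (congrFun G.symm j) i

theorem weight_nonneg (i j : Fin N) : 0 ≤ G.weight i j := by
  by_cases h : G.graph.Adj i j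
  · exact (G.pos i j h).le
  · exact (G.zero i j h).ge

theorem laplacian_apply_comm (i j : Fin N) : G.laplacian i j = G.laplacian j i := by
  have := congrFun (congrFun G.laplacian_isHermitian j) i
  simpa using this

theorem sum_laplacian (i : Fin N) : ∑ j, G.laplacian i j = 0 := by
  simp [laplacian, Matrix.diagonal_apply, Finset.sum_sub_distrib]

theorem laplacian_quadForm (u : Fin N → ℝ) :
    u ⬝ᵥ G.laplacian *ᵥ u = 1 / 2 * ∑ i, ∑ j, G.weight i j * (u i - u j) ^ 2 := by
  have h1 : u ⬝ᵥ G.laplacian *ᵥ u = ∑ i, ∑ j, G.weight i j * (u i ^ 2 - u i * u j) := by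
    rw [laplacian, Matrix.sub_mulVec]
    simp only [dotProduct, Pi.sub_apply, Matrix.mulVec_diagonal]
    refine Finset.sum_congr rfl fun i _ => ?_
    rw [Matrix.mulVec, dotProduct, Finset.sum_mul, ← Finset.sum_sub_distrib, Finset.mul_sum]
    exact Finset.sum_congr rfl fun j _ => by ring
  have h2 : ∑ i, ∑ j, G.weight i j * (u i ^ 2 - u i * u j)
      = ∑ i, ∑ j, G.weight i j * (u j ^ 2 - u i * u j) := by
    rw [Finset.sum_comm]
    refine Finset.sum_congr rfl fun i _ => Finset.sum_congr rfl fun j _ => ?_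
    rw [G.weight_comm]; ring
  have h3 : ∑ i, ∑ j, G.weight i j * (u i - u j) ^ 2
      = ∑ i, ∑ j, G.weight i j * (u i ^ 2 - u i * u j)
        + ∑ i, ∑ j, G.weight i j * (u j ^ 2 - u i * u j) := by
    simp only [← Finset.sum_add_distrib]
    exact Finset.sum_congr rfl fun i _ => Finset.sum_congr rfl fun j _ => by ring
  rw [h1, h3, ← h2]; ring

theorem laplacian_posSemidef : G.laplacian.PosSemidef := by
  refine Matrix.PosSemidef.of_dotProduct_mulVec_nonneg G.laplacian_isHermitian fun u => ?_
  rw [star_trivial, laplacian_quadForm]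
  exact mul_nonneg (by norm_num) (Finset.sum_nonneg fun i _ => Finset.sum_nonneg fun j _ =>
    mul_nonneg (G.weight_nonneg i j) (sq_nonneg _))

/-- Expand in an orthonormal eigenbasis. If `λ₂ ≤ 0`, semidefiniteness suffices. If `λ₂ > 0`, the
kernel vector `1` is orthogonal to every eigenvector except the one of least eigenvalue, hence is a
multiple of it, and `u ⊥ 1` removes that term. -/
theorem lambda2_mul_le (hN : 2 ≤ N) {u : Fin N → ℝ} (hu : ∑ i, u i = 0) :
    G.lambda2 hN * (u ⬝ᵥ u) ≤ u ⬝ᵥ G.laplacian *ᵥ u := by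
  set hA := G.laplacian_isHermitian with hAdef
  set b := hA.eigenvectorBasis with hb
  have hLb : ∀ (v : Fin N → ℝ) (j : Fin N),
      (b j).ofLp ⬝ᵥ (G.laplacian *ᵥ v) = hA.eigenvalues j * ((b j).ofLp ⬝ᵥ v) := by
    intro v j
    have h1 : G.laplacian *ᵥ (b j).ofLp = hA.eigenvalues j • (b j).ofLp :=
      hA.mulVec_eigenvectorBasis j
    have hT : G.laplacianᵀ = G.laplacian := by
      simpa using G.laplacian_isHermitian.eq
    rw [Matrix.dotProduct_mulVec, ← Matrix.mulVec_transpose, hT, h1, smul_dotProduct, smul_eq_mul]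
  have hexp : ∀ v w : Fin N → ℝ,
      v ⬝ᵥ w = ∑ j, ((b j).ofLp ⬝ᵥ v) * ((b j).ofLp ⬝ᵥ w) := by
    intro v w
    have := b.sum_inner_mul_inner (WithLp.toLp 2 v) (WithLp.toLp 2 w)
    simp only [EuclideanSpace.inner_eq_star_dotProduct, star_trivial] at this
    rw [dotProduct_comm v w, ← this]
    exact Finset.sum_congr rfl fun j _ => by rw [dotProduct_comm w]
  have hev0 : ∀ j, 0 ≤ hA.eigenvalues j := G.laplacian_posSemidef.eigenvalues_nonneg
  rw [hexp u (G.laplacian *ᵥ u), hexp u u, Finset.mul_sum]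
  simp only [hLb]
  rcases le_or_gt (G.lambda2 hN) 0 with hle | hpos
  · refine Finset.sum_le_sum fun j _ => ?_
    have h0 := mul_self_nonneg ((b j).ofLp ⬝ᵥ u)
    nlinarith [hev0 j]
  set σ : Fin (Fintype.card (Fin N)) ≃ Fin N := Fintype.equivOfCardEq (Fintype.card_fin _) with hσ
  -- The eigenvalues are listed in decreasing order, so the last position `N - 1` carries the
  -- smallest and every other position is at most `N - 2`.
  set j₀ : Fin N := σ ⟨N - 1, by rw [Fintype.card_fin]; omega⟩ with hj₀
  have hlarge : ∀ j, j ≠ j₀ → G.lambda2 hN ≤ hA.eigenvalues j := by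
    intro j hj
    refine hA.eigenvalues₀_antitone ?_
    have h1 : (σ.symm j).1 < N :=
      (σ.symm j).2.trans_eq (Fintype.card_fin N)
    have h2 : (σ.symm j).1 ≠ N - 1 := by
      intro h
      apply hj
      rw [hj₀, ← σ.symm_apply_eq]
      exact Fin.ext h
    rw [Fin.le_def]
    show (σ.symm j).1 ≤ N - 2
    omega
  have hone : G.laplacian *ᵥ (fun _ => 1) = 0 := by
    funext i
    simpa [Matrix.mulVec, dotProduct] using G.sum_laplacian i
  have horth : ∀ j, j ≠ j₀ → (b j).ofLp ⬝ᵥ (fun _ => 1) = 0 := by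
    intro j hj
    have h1 := hLb (fun _ => 1) j
    rw [hone, dotProduct_zero] at h1
    exact (mul_eq_zero.1 h1.symm).resolve_left (by linarith [hlarge j hj])
  have hu0 : (b j₀).ofLp ⬝ᵥ u = 0 := by
    have h1 := hexp (fun _ => 1) (fun _ => 1)
    have h2 := hexp (fun _ => 1) u
    rw [Finset.sum_eq_single j₀ (fun j _ hj => by rw [horth j hj, zero_mul]) (by simp)] at h1 h2
    have h3 : (fun _ : Fin N => (1 : ℝ)) ⬝ᵥ u = 0 := by simpa [dotProduct] using hu
    rw [h3] at h2
    refine (mul_eq_zero.1 h2.symm).resolve_left fun h => ?_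
    rw [h] at h1
    simp [dotProduct] at h1
    omega
  refine Finset.sum_le_sum fun j _ => ?_
  rcases eq_or_ne j j₀ with rfl | hj
  · rw [hu0]; simp
  · have h0 := mul_self_nonneg ((b j).ofLp ⬝ᵥ u)
    nlinarith [hlarge j hj]

/-- On a connected graph, the kernel of the Laplacian consists of the constant vectors. -/
theorem eq_of_laplacian_mulVec_eq_zero (hG : G.graph.Connected) {u : Fin N → ℝ}
    (hu : G.laplacian *ᵥ u = 0) (i j : Fin N) : u i = u j := by
  have h0 := G.laplacian_quadForm u
  rw [hu, dotProduct_zero, eq_comm, mul_eq_zero, or_iff_right (by norm_num)] at h0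
  have hnn : ∀ i j, 0 ≤ G.weight i j * (u i - u j) ^ 2 := fun i j =>
    mul_nonneg (G.weight_nonneg i j) (sq_nonneg _)
  rw [Finset.sum_eq_zero_iff_of_nonneg fun i _ => Finset.sum_nonneg fun j _ => hnn i j] at h0
  have hadj : ∀ i j, G.graph.Adj i j → u i = u j := by
    intro i j h
    have h1 := (Finset.sum_eq_zero_iff_of_nonneg fun j _ => hnn i j).1 (h0 i (Finset.mem_univ _)) j
      (Finset.mem_univ _)
    have h2 := (mul_eq_zero.1 h1).resolve_left (G.pos i j h).ne'
    exact sub_eq_zero.1 (pow_eq_zero_iff two_ne_zero |>.1 h2)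
  obtain ⟨p⟩ := hG.preconnected i j
  induction p with
  | nil => rfl
  | cons h _ ih => exact (hadj _ _ h).trans ih

end CommGraph

/-! ### Consensus decomposition of stacked vectors -/

section Consensus

variable {N : ℕ} {d : Fin N → ℕ}

/-- `1_N ⊗ x` as a linear map. -/
def consensusMap (d : Fin N → ℕ) : Profile d →ₗ[ℝ] Stacked d where
  toFun := consensus
  map_add' _ _ := rfl
  map_smul' _ _ := rfl

/-- The average `(1/N) Σ_i x^i` of the estimates. -/
def average (d : Fin N → ℕ) : Stacked d →ₗ[ℝ] Profile d where
  toFun X := WithLp.toLp 2 fun s => 1 / (N : ℝ) * ∑ i, X (i, s)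
  map_add' X Y := by
    ext s; simp [Finset.sum_add_distrib, mul_add]
  map_smul' a X := by
    ext s; simp [← Finset.mul_sum]; ring

/-- The disagreement part of a stacked vector. -/
def disagreement (d : Fin N → ℕ) : Stacked d →ₗ[ℝ] Stacked d :=
  LinearMap.id - consensusMap d ∘ₗ average d

@[simp] theorem average_apply (X : Stacked d) (s : Coord d) :
    average d X s = 1 / (N : ℝ) * ∑ i, X (i, s) := rfl

@[simp] theorem consensusMap_apply (x : Profile d) (p : Fin N × Coord d) :
    consensusMap d x p = x p.2 := rfl

theorem eq_consensus_add_disagreement (X : Stacked d) :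
    X = consensusMap d (average d X) + disagreement d X := by
  simp [disagreement]

theorem inner_consensusMap (x : Profile d) (Y : Stacked d) :
    inner ℝ (consensusMap d x) Y = N * inner ℝ x (average d Y) := by
  rcases Nat.eq_zero_or_pos N with rfl | hN
  · simp [PiLp.inner_apply]
  have hN' : (N : ℝ) ≠ 0 := by exact_mod_cast hN.ne'
  simp only [PiLp.inner_apply, Fintype.sum_prod_type, RCLike.inner_apply, conj_trivial,
    consensusMap_apply, average_apply]
  rw [Finset.sum_comm, Finset.mul_sum]
  refine Finset.sum_congr rfl fun s _ => ?_
  rw [← Finset.sum_mul]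
  field_simp

theorem average_consensusMap (hN : 0 < N) (x : Profile d) : average d (consensusMap d x) = x := by
  have hN' : (N : ℝ) ≠ 0 := by exact_mod_cast hN.ne'
  ext s
  simp [hN']

theorem norm_consensusMap (hN : 0 < N) (x : Profile d) : ‖consensusMap d x‖ = √N * ‖x‖ := by
  rw [← sq_eq_sq₀ (norm_nonneg _) (by positivity), mul_pow, Real.sq_sqrt (by positivity),
    ← real_inner_self_eq_norm_sq, ← real_inner_self_eq_norm_sq, inner_consensusMap,
    average_consensusMap hN]

theorem average_disagreement (hN : 0 < N) (X : Stacked d) : average d (disagreement d X) = 0 := by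
  rw [disagreement, LinearMap.sub_apply, map_sub, LinearMap.comp_apply, average_consensusMap hN,
    LinearMap.id_apply, sub_self]

/-- `disagreement` is the orthogonal projection onto the vectors of zero average. -/
theorem inner_disagreement_disagreement (hN : 0 < N) (X Y : Stacked d) :
    inner ℝ (disagreement d X) (disagreement d Y) = inner ℝ (disagreement d X) Y := by
  conv_rhs => rw [eq_consensus_add_disagreement Y]
  rw [inner_add_right, real_inner_comm (consensusMap d _), inner_consensusMap,
    average_disagreement hN, inner_zero_right, mul_zero, zero_add]

/-! ### The linear parts of the dynamics -/

theorem toEuclideanLin_selection_transpose_apply (y : Profile d) (p : Fin N × Coord d) :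
    Matrix.toEuclideanLin (selection d)ᵀ y p = if p.1 = p.2.1 then y p.2 else 0 := by
  simp only [Matrix.ofLp_toLpLin, Matrix.toLin'_apply, Matrix.mulVec, dotProduct, selection,
    Matrix.transpose_apply, Matrix.of_apply, ite_mul, one_mul, zero_mul]
  split_ifs with h
  · rw [Finset.sum_eq_single p.2]
    · have hp : p = (p.2.1, p.2) := Prod.ext h rfl
      rw [if_pos hp]
    · intro t _ ht
      rw [if_neg]
      rintro rfl
      exact ht rfl
    · simp
  · refine Finset.sum_eq_zero fun t _ => if_neg ?_
    rintro rfl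
    exact h rfl

theorem average_selection_transpose (y : Profile d) :
    average d (Matrix.toEuclideanLin (selection d)ᵀ y) = (1 / (N : ℝ)) • y := by
  ext s
  simp [toEuclideanLin_selection_transpose_apply]

theorem norm_selection_transpose (y : Profile d) :
    ‖Matrix.toEuclideanLin (selection d)ᵀ y‖ = ‖y‖ := by
  rw [← sq_eq_sq₀ (norm_nonneg _) (norm_nonneg _), EuclideanSpace.norm_sq_eq,
    EuclideanSpace.norm_sq_eq, Fintype.sum_prod_type, Finset.sum_comm]
  simp [toEuclideanLin_selection_transpose_apply, apply_ite norm, ite_pow]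

theorem extGameMatrix_consensusMap (Q : Fin N → Matrix (Coord d) (Coord d) ℝ) (x : Profile d) :
    Matrix.toEuclideanLin (extGameMatrix Q) (consensusMap d x)
      = Matrix.toEuclideanLin (gameMatrix Q) x := by
  ext s
  simp [extGameMatrix, Matrix.mulVec, dotProduct, Fintype.sum_prod_type, ite_mul]

theorem laplacian_kronecker_apply (L : Matrix (Fin N) (Fin N) ℝ) (X : Stacked d)
    (p : Fin N × Coord d) :
    Matrix.toEuclideanLin (L ⊗ₖ (1 : Matrix (Coord d) (Coord d) ℝ)) X p
      = ∑ j, L p.1 j * X (j, p.2) := by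
  simp [Matrix.mulVec, dotProduct, Fintype.sum_prod_type, Matrix.one_apply]

theorem average_laplacian (G : CommGraph N) (X : Stacked d) :
    average d (Matrix.toEuclideanLin (G.laplacian ⊗ₖ (1 : Matrix (Coord d) (Coord d) ℝ)) X) = 0 := by
  ext s
  simp only [average_apply, laplacian_kronecker_apply]
  rw [Finset.sum_comm, Finset.sum_eq_zero fun j _ => ?_, mul_zero, PiLp.zero_apply]
  rw [← Finset.sum_mul, Finset.sum_congr rfl fun i _ => G.laplacian_apply_comm i j,
    G.sum_laplacian, zero_mul]

theorem laplacian_consensusMap (G : CommGraph N) (x : Profile d) :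
    Matrix.toEuclideanLin (G.laplacian ⊗ₖ (1 : Matrix (Coord d) (Coord d) ℝ)) (consensusMap d x)
      = 0 := by
  ext p
  rw [laplacian_kronecker_apply]
  simp [← Finset.sum_mul, G.sum_laplacian]

/-- The Laplacian kills the consensus part; on the rest, `lambda2_mul_le` applies to each coordinate
of the joint action separately. -/
theorem lambda2_mul_norm_disagreement_le (G : CommGraph N) (hN : 2 ≤ N) (X : Stacked d) :
    G.lambda2 hN * ‖disagreement d X‖ ^ 2 ≤ inner ℝ (disagreement d X)
      (Matrix.toEuclideanLin (G.laplacian ⊗ₖ (1 : Matrix (Coord d) (Coord d) ℝ)) X) := by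
  have h0 : Matrix.toEuclideanLin (G.laplacian ⊗ₖ (1 : Matrix (Coord d) (Coord d) ℝ)) X
      = Matrix.toEuclideanLin (G.laplacian ⊗ₖ (1 : Matrix (Coord d) (Coord d) ℝ))
        (disagreement d X) := by
    conv_lhs => rw [eq_consensus_add_disagreement X, map_add, laplacian_consensusMap, zero_add]
  rw [h0]
  set Y := disagreement d X with hY
  have havg : ∀ s, ∑ i, Y (i, s) = 0 := by
    intro s
    have h1 := congrFun (congrArg WithLp.ofLp (average_disagreement (by omega) X)) s
    have hN' : (N : ℝ) ≠ 0 := by positivity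
    rw [← hY] at h1
    simpa [hN'] using h1
  have hsum : inner ℝ Y (Matrix.toEuclideanLin
      (G.laplacian ⊗ₖ (1 : Matrix (Coord d) (Coord d) ℝ)) Y)
      = ∑ s, (fun i => Y (i, s)) ⬝ᵥ G.laplacian *ᵥ (fun i => Y (i, s)) := by
    simp only [PiLp.inner_apply, Fintype.sum_prod_type, RCLike.inner_apply, conj_trivial,
      laplacian_kronecker_apply]
    rw [Finset.sum_comm]
    exact Finset.sum_congr rfl fun s _ => Finset.sum_congr rfl fun i _ => mul_comm _ _
  have hnorm : ‖Y‖ ^ 2 = ∑ s, (fun i => Y (i, s)) ⬝ᵥ (fun i => Y (i, s)) := by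
    rw [EuclideanSpace.norm_sq_eq, Fintype.sum_prod_type, Finset.sum_comm]
    refine Finset.sum_congr rfl fun s _ => Finset.sum_congr rfl fun i _ => ?_
    rw [Real.norm_eq_abs, sq_abs, pow_two]
  rw [hsum, hnorm, Finset.mul_sum]
  exact Finset.sum_le_sum fun s _ => G.lambda2_mul_le hN (havg s)

theorem disagreement_eq_zero_of_laplacian (G : CommGraph N) (hG : G.graph.Connected) (hN : 0 < N)
    {X : Stacked d}
    (hX : Matrix.toEuclideanLin (G.laplacian ⊗ₖ (1 : Matrix (Coord d) (Coord d) ℝ)) X = 0) :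
    disagreement d X = 0 := by
  have hc : ∀ s i j, X (i, s) = X (j, s) := by
    intro s
    refine G.eq_of_laplacian_mulVec_eq_zero hG (u := fun i => X (i, s)) ?_
    funext i
    have := congrFun (congrArg WithLp.ofLp hX) (i, s)
    rwa [laplacian_kronecker_apply] at this
  have hX' : X = consensusMap d (WithLp.toLp 2 fun s => X (⟨0, hN⟩, s)) := by
    ext ⟨i, s⟩
    exact hc s _ _
  rw [hX', disagreement, LinearMap.sub_apply, LinearMap.comp_apply, average_consensusMap hN,
    LinearMap.id_apply, sub_self]

end Consensus

/-! ### The closed loop -/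

section ClosedLoop

variable {N : ℕ} {d : Fin N → ℕ}

/-- The extended Laplacian `L ⊗ I`. -/
abbrev extLaplacian (G : CommGraph N) (d : Fin N → ℕ) : Stacked d →ₗ[ℝ] Stacked d :=
  Matrix.toEuclideanLin (G.laplacian ⊗ₖ (1 : Matrix (Coord d) (Coord d) ℝ))

/-- The linear part of the dynamics. -/
def closedLoop (Q : Fin N → Matrix (Coord d) (Coord d) ℝ) (G : CommGraph N) (α β c : ℝ) :
    (Stacked d × Stacked d) →ₗ[ℝ] (Stacked d × Stacked d) where
  toFun w := (-(Matrix.toEuclideanLin (selection d)ᵀ (Matrix.toEuclideanLin (extGameMatrix Q) w.1))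
      - β • (w.1 - w.2) - c • extLaplacian G d w.1, α • (w.1 - w.2))
  map_add' v w := by
    ext1
    · simp only [Prod.fst_add, Prod.snd_add, map_add]; module
    · simp only [Prod.fst_add, Prod.snd_add]; module
  map_smul' a w := by
    ext1
    · simp only [Prod.smul_fst, Prod.smul_snd, map_smul, RingHom.id_apply]; module
    · simp only [Prod.smul_fst, Prod.smul_snd, RingHom.id_apply]; module

/-- On consensual states `𝐀` acts as `A`, so `𝐀(1 ⊗ x) + b = F(x) = 0` absorbs the constant term;
the other terms vanish at the equilibrium. -/
theorem heavyAnchorField_quadCost {Q : Fin N → Matrix (Coord d) (Coord d) ℝ}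
    (hQ : ∀ i, (Q i)ᵀ = Q i) (l : Fin N → Coord d → ℝ) (e : Fin N → ℝ) (G : CommGraph N)
    (α β c : ℝ) {x : Profile d} (hx : pseudoGrad (quadCost Q l e) x = 0)
    (w : Stacked d × Stacked d) :
    heavyAnchorField (quadCost Q l e) G.laplacian α β c w
      = closedLoop Q G α β c (w - (consensus x, consensus x)) := by
  have h1 : extPseudoGrad (quadCost Q l e) w.1
      = Matrix.toEuclideanLin (extGameMatrix Q) (w.1 - consensusMap d x) := by
    rw [pseudoGrad_quadCost hQ, ← extGameMatrix_consensusMap] at hx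
    rw [extPseudoGrad_quadCost hQ, map_sub, eq_neg_of_add_eq_zero_left hx, sub_neg_eq_add]
  have h2 : extLaplacian G d (w.1 - consensusMap d x) = extLaplacian G d w.1 := by
    rw [map_sub, laplacian_consensusMap, sub_zero]
  have h3 : w.1 - consensusMap d x - (w.2 - consensusMap d x) = w.1 - w.2 := by abel
  change _ = (-(Matrix.toEuclideanLin (selection d)ᵀ
    (Matrix.toEuclideanLin (extGameMatrix Q) (w.1 - consensusMap d x)))
    - β • (w.1 - consensusMap d x - (w.2 - consensusMap d x))
    - c • extLaplacian G d (w.1 - consensusMap d x),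
    α • (w.1 - consensusMap d x - (w.2 - consensusMap d x)))
  rw [h2, h3, ← h1]
  rfl

/-- Stacks two joint actions. -/
def stackPair (d : Fin N → ℕ) :
    (Profile d × Profile d) →ₗ[ℝ] EuclideanSpace ℝ (Coord d ⊕ Coord d) where
  toFun z := WithLp.toLp 2 (Sum.elim z.1 z.2)
  map_add' y z := by ext (i | i) <;> rfl
  map_smul' a z := by ext (i | i) <;> rfl

theorem norm_sq_stackPair (x r : Profile d) : ‖stackPair d (x, r)‖ ^ 2 = ‖x‖ ^ 2 + ‖r‖ ^ 2 := by
  simp [EuclideanSpace.norm_sq_eq, stackPair]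

theorem norm_fst_le_norm_stackPair (x r : Profile d) : ‖x‖ ≤ ‖stackPair d (x, r)‖ := by
  rw [← sq_le_sq₀ (norm_nonneg _) (norm_nonneg _), norm_sq_stackPair]
  exact le_add_of_nonneg_right (sq_nonneg _)

/-- The averaged state `col(x̄, r̄)`. -/
def averagedState (d : Fin N → ℕ) :
    (Stacked d × Stacked d) →ₗ[ℝ] EuclideanSpace ℝ (Coord d ⊕ Coord d) :=
  stackPair d ∘ₗ (average d).prodMap (average d)

theorem averagedState_apply (w : Stacked d × Stacked d) :
    averagedState d w = stackPair d (average d w.1, average d w.2) := rfl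

/-- Averaging annihilates the Laplacian and turns `𝓡ᵀ` into `1/N`, which is the factor in `scaledM`;
what remains is the error of evaluating gradients away from consensus. -/
theorem averagedState_closedLoop (Q : Fin N → Matrix (Coord d) (Coord d) ℝ)
    (G : CommGraph N) (α β c : ℝ) (w : Stacked d × Stacked d) :
    averagedState d (closedLoop Q G α β c w)
      = Matrix.toEuclideanLin (scaledM (gameMatrix Q) α β) (averagedState d w)
        + stackPair d (-((1 / (N : ℝ)) •
          Matrix.toEuclideanLin (extGameMatrix Q) (disagreement d w.1)), 0) := by
  have h1 : average d (closedLoop Q G α β c w).1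
      = -((1 / (N : ℝ)) • Matrix.toEuclideanLin (gameMatrix Q) (average d w.1))
        - β • (average d w.1 - average d w.2)
        - (1 / (N : ℝ)) • Matrix.toEuclideanLin (extGameMatrix Q) (disagreement d w.1) := by
    change average d (-(Matrix.toEuclideanLin (selection d)ᵀ
      (Matrix.toEuclideanLin (extGameMatrix Q) w.1)) - β • (w.1 - w.2) - c • extLaplacian G d w.1) = _
    rw [map_sub, map_sub, map_neg, map_smul, map_smul, map_sub, average_laplacian,
      average_selection_transpose]
    conv_lhs => rw [eq_consensus_add_disagreement w.1]
    rw [map_add (Matrix.toEuclideanLin (extGameMatrix Q)), extGameMatrix_consensusMap,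
      ← eq_consensus_add_disagreement w.1]
    module
  have h2 : average d (closedLoop Q G α β c w).2 = α • (average d w.1 - average d w.2) := by
    change average d (α • (w.1 - w.2)) = _
    rw [map_smul, map_sub]
  rw [averagedState_apply, h1, h2, averagedState_apply]
  ext (i | i)
  · simp [stackPair, scaledM, Matrix.fromBlocks_mulVec, Matrix.sub_mulVec, Matrix.neg_mulVec,
      Matrix.smul_mulVec]
    ring
  · simp [stackPair, scaledM, Matrix.fromBlocks_mulVec, Matrix.neg_mulVec, Matrix.smul_mulVec]
    ring

/-- The bilinear form whose quadratic form is the Lyapunov function of the closed loop. -/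
def lyapunovForm (P : Matrix (Coord d ⊕ Coord d) (Coord d ⊕ Coord d) ℝ) (α β : ℝ)
    (v w : Stacked d × Stacked d) : ℝ :=
  2 * N * inner ℝ (averagedState d v) (Matrix.toEuclideanLin P (averagedState d w))
    + inner ℝ (disagreement d v.1) (disagreement d w.1)
    + β / α * inner ℝ (disagreement d v.2) (disagreement d w.2)

theorem inner_toEuclideanLin_comm {n : Type*} [Fintype n] [DecidableEq n] {P : Matrix n n ℝ}
    (hP : P.IsHermitian) (x y : EuclideanSpace ℝ n) :
    inner ℝ x (Matrix.toEuclideanLin P y) = inner ℝ y (Matrix.toEuclideanLin P x) := by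
  have hT : Pᵀ = P := by simpa using hP.eq
  simp only [EuclideanSpace.inner_eq_star_dotProduct, star_trivial, Matrix.ofLp_toLpLin,
    Matrix.toLin'_apply]
  rw [dotProduct_comm, Matrix.dotProduct_mulVec, ← Matrix.mulVec_transpose, hT]

theorem lyapunovForm_comm {P : Matrix (Coord d ⊕ Coord d) (Coord d ⊕ Coord d) ℝ}
    (hP : P.IsHermitian) (α β : ℝ) (v w : Stacked d × Stacked d) :
    lyapunovForm P α β v w = lyapunovForm P α β w v := by
  rw [lyapunovForm, lyapunovForm, inner_toEuclideanLin_comm hP, real_inner_comm (disagreement d v.1),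
    real_inner_comm (disagreement d v.2)]

theorem lyapunovForm_self_nonneg {P : Matrix (Coord d ⊕ Coord d) (Coord d ⊕ Coord d) ℝ}
    (hP : P.PosDef) {α β : ℝ} (hα : 0 < α) (hβ : 0 < β) (w : Stacked d × Stacked d) :
    0 ≤ lyapunovForm P α β w w := by
  obtain ⟨m, hm, h⟩ := exists_pos_mul_sq_le_of_posDef hP
  have h1 := h (averagedState d w)
  have h2 : 0 ≤ inner ℝ (averagedState d w) (Matrix.toEuclideanLin P (averagedState d w)) :=
    le_trans (by positivity) h1
  have h3 := real_inner_self_nonneg (x := disagreement d w.1)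
  have h4 := real_inner_self_nonneg (x := disagreement d w.2)
  rw [lyapunovForm]
  positivity

theorem lyapunovForm_smul_add_smul (P : Matrix (Coord d ⊕ Coord d) (Coord d ⊕ Coord d) ℝ) (α β : ℝ)
    (u v w : Stacked d × Stacked d) (a b : ℝ) :
    lyapunovForm P α β u (a • v + b • w)
      = a * lyapunovForm P α β u v + b * lyapunovForm P α β u w := by
  simp only [lyapunovForm, Prod.fst_add, Prod.snd_add, Prod.smul_fst, Prod.smul_snd, map_add,
    map_smul, inner_add_right, inner_smul_right]
  ring

theorem two_mul_inner_of_lyapunov {n : Type*} [Fintype n] [DecidableEq n] {P M : Matrix n n ℝ}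
    (hP : P.IsHermitian) (h : P * M + Mᵀ * P = -1) (z : EuclideanSpace ℝ n) :
    2 * inner ℝ z (Matrix.toEuclideanLin P (Matrix.toEuclideanLin M z)) = -‖z‖ ^ 2 := by
  rw [← inner_add_inner_of_lyapunov h, two_mul]
  congr 1
  exact inner_toEuclideanLin_comm hP _ _

/-- The left side is half the derivative of the Lyapunov function. The weight `2N` yields `-N‖z‖²`
from the Lyapunov equation, and `β/α` merges the anchor terms into `-β‖X - Y‖²`. The cross terms add
up to `(2‖P‖ + √N) a ‖z‖ ‖X‖`, where `a = ‖𝐀‖`; the bound on `cλ₂` is what completes the square. -/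
theorem lyapunovForm_closedLoop_le {Q : Fin N → Matrix (Coord d) (Coord d) ℝ}
    {G : CommGraph N} (hN : 2 ≤ N) {α β c : ℝ} (hα : 0 < α) (hc : 0 < c)
    {P : Matrix (Coord d ⊕ Coord d) (Coord d ⊕ Coord d) ℝ} (hP : P.IsHermitian)
    (hL : P * scaledM (gameMatrix Q) α β + (scaledM (gameMatrix Q) α β)ᵀ * P = -1)
    (hcL : c * G.lambda2 hN ≥ ‖extGameMatrix Q‖
      + (‖extGameMatrix Q‖ * (‖P‖ / √(N : ℝ) + 1 / 2)) ^ 2) (w : Stacked d × Stacked d) :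
    lyapunovForm P α β w (closedLoop Q G α β c w) ≤
      -(√N * ‖averagedState d w‖ - ‖extGameMatrix Q‖ * (‖P‖ / √(N : ℝ) + 1 / 2)
          * ‖disagreement d w.1‖) ^ 2
        - β * ‖disagreement d w.1 - disagreement d w.2‖ ^ 2 := by
  have hN0 : 0 < N := by omega
  have hNR : (0 : ℝ) < N := by exact_mod_cast hN0
  set z := averagedState d w with hz
  set X := disagreement d w.1 with hX
  set Y := disagreement d w.2 with hY
  set a := ‖extGameMatrix Q‖ with ha
  set AX := Matrix.toEuclideanLin (extGameMatrix Q) X with hAX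
  have hA : ∀ V : Stacked d, ‖Matrix.toEuclideanLin (extGameMatrix Q) V‖ ≤ a * ‖V‖ :=
    Matrix.l2_opNorm_mulVec _
  have h1 : 2 * N * inner ℝ z (Matrix.toEuclideanLin P (averagedState d (closedLoop Q G α β c w)))
      ≤ -(N * ‖z‖ ^ 2) + 2 * ‖P‖ * a * ‖z‖ * ‖X‖ := by
    set g := stackPair d (-((1 / (N : ℝ)) • AX), 0) with hg
    have hgn : ‖g‖ ≤ 1 / N * (a * ‖X‖) := by
      rw [← sq_le_sq₀ (norm_nonneg _) (by positivity), hg, norm_sq_stackPair, norm_neg, norm_smul,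
        norm_zero, Real.norm_of_nonneg (by positivity)]
      have := hA X
      simp only [ne_eq, OfNat.ofNat_ne_zero, not_false_eq_true, zero_pow, add_zero]
      gcongr
    have h2 : inner ℝ z (Matrix.toEuclideanLin P g) ≤ ‖z‖ * (‖P‖ * (1 / N * (a * ‖X‖))) := by
      refine (real_inner_le_norm _ _).trans ?_
      gcongr
      exact (Matrix.l2_opNorm_mulVec P g).trans (by gcongr)
    rw [averagedState_closedLoop, ← hX, ← hAX, ← hg, map_add, inner_add_right]
    have h3 := two_mul_inner_of_lyapunov hP hL z
    calc _ = N * (2 * inner ℝ z (Matrix.toEuclideanLin P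
            (Matrix.toEuclideanLin (scaledM (gameMatrix Q) α β) z)))
            + 2 * N * inner ℝ z (Matrix.toEuclideanLin P g) := by ring
      _ ≤ N * (-‖z‖ ^ 2) + 2 * N * (‖z‖ * (‖P‖ * (1 / N * (a * ‖X‖)))) := by
          rw [h3]; gcongr
      _ = _ := by field_simp
  have h2 : inner ℝ X (disagreement d (closedLoop Q G α β c w).1)
      ≤ a * ‖X‖ * (√N * ‖z‖ + ‖X‖) - β * inner ℝ X (X - Y) - c * (G.lambda2 hN * ‖X‖ ^ 2) := by
    rw [hX, inner_disagreement_disagreement hN0]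
    change inner ℝ (disagreement d w.1) (-(Matrix.toEuclideanLin (selection d)ᵀ
      (Matrix.toEuclideanLin (extGameMatrix Q) w.1)) - β • (w.1 - w.2) - c • extLaplacian G d w.1) ≤ _
    rw [inner_sub_right, inner_sub_right, inner_neg_right, inner_smul_right, inner_smul_right,
      ← inner_disagreement_disagreement hN0 w.1 (w.1 - w.2), map_sub, ← hX, ← hY]
    have h3 := mul_le_mul_of_nonneg_left (lambda2_mul_norm_disagreement_le G hN w.1) hc.le
    rw [← hX] at h3
    have h4 : -inner ℝ X (Matrix.toEuclideanLin (selection d)ᵀ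
        (Matrix.toEuclideanLin (extGameMatrix Q) w.1)) ≤ a * ‖X‖ * (√N * ‖z‖ + ‖X‖) := by
      rw [← inner_neg_right]
      refine (real_inner_le_norm _ _).trans ?_
      rw [norm_neg, norm_selection_transpose]
      have h5 : ‖Matrix.toEuclideanLin (extGameMatrix Q) w.1‖ ≤ a * (√N * ‖z‖ + ‖X‖) := by
        refine (hA _).trans ?_
        gcongr
        conv_lhs => rw [eq_consensus_add_disagreement w.1]
        refine (norm_add_le _ _).trans ?_
        rw [norm_consensusMap hN0]
        gcongr
        exact norm_fst_le_norm_stackPair _ _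
      calc _ ≤ ‖X‖ * (a * (√N * ‖z‖ + ‖X‖)) := by gcongr
        _ = _ := by ring
    linarith
  have h3 : inner ℝ Y (disagreement d (closedLoop Q G α β c w).2) = α * inner ℝ Y (X - Y) := by
    change inner ℝ Y (disagreement d (α • (w.1 - w.2))) = _
    rw [map_smul, map_sub, inner_smul_right]
  have h4 : ‖X - Y‖ ^ 2 = inner ℝ X (X - Y) - inner ℝ Y (X - Y) := by
    rw [← inner_sub_left, real_inner_self_eq_norm_sq]
  rw [lyapunovForm, ← hz, ← hX, ← hY, h3, h4]
  have h5 : β / α * (α * inner ℝ Y (X - Y)) = β * inner ℝ Y (X - Y) := by field_simp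
  have hs : √(N : ℝ) ^ 2 = N := Real.sq_sqrt hNR.le
  have hs0 : 0 < √(N : ℝ) := Real.sqrt_pos.2 hNR
  have h6 : (√N * ‖z‖ - a * (‖P‖ / √(N : ℝ) + 1 / 2) * ‖X‖) ^ 2
      = N * ‖z‖ ^ 2 - 2 * ‖P‖ * a * ‖z‖ * ‖X‖ - a * √N * ‖z‖ * ‖X‖
        + (a * (‖P‖ / √(N : ℝ) + 1 / 2)) ^ 2 * ‖X‖ ^ 2 := by
    rw [show N * ‖z‖ ^ 2 = √(N : ℝ) ^ 2 * ‖z‖ ^ 2 by rw [hs]]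
    field_simp
    ring
  have h7 := mul_le_mul_of_nonneg_right hcL (sq_nonneg ‖X‖)
  rw [h5, h6]
  linarith

theorem eq_zero_of_average_of_disagreement {X : Stacked d} (h1 : average d X = 0)
    (h2 : disagreement d X = 0) : X = 0 := by
  rw [eq_consensus_add_disagreement X, h1, h2]; simp

theorem eq_zero_of_averagedState {w : Stacked d × Stacked d} (h : averagedState d w = 0)
    (h1 : disagreement d w.1 = 0) (h2 : disagreement d w.2 = 0) : w = 0 := by
  have h3 := norm_sq_stackPair (average d w.1) (average d w.2)
  rw [← averagedState_apply, h, norm_zero] at h3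
  have h4 : ‖average d w.1‖ = 0 := by nlinarith [sq_nonneg ‖average d w.1‖, sq_nonneg ‖average d w.2‖]
  have h5 : ‖average d w.2‖ = 0 := by nlinarith [sq_nonneg ‖average d w.1‖, sq_nonneg ‖average d w.2‖]
  exact Prod.ext (eq_zero_of_average_of_disagreement (norm_eq_zero.1 h4) h1)
    (eq_zero_of_average_of_disagreement (norm_eq_zero.1 h5) h2)

/-- The closed loop has trivial kernel. -/
theorem eq_zero_of_closedLoop_eq_zero {Q : Fin N → Matrix (Coord d) (Coord d) ℝ}
    (hA : (gameMatrix Q).det ≠ 0) {G : CommGraph N} (hG : G.graph.Connected) (hN : 0 < N)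
    {α β c : ℝ} (hα : 0 < α) (hc : 0 < c) {w : Stacked d × Stacked d}
    (hw : closedLoop Q G α β c w = 0) : w = 0 := by
  have h2 : w.1 - w.2 = 0 := (smul_eq_zero.1 (congrArg Prod.snd hw)).resolve_left hα.ne'
  have h1 : -(Matrix.toEuclideanLin (selection d)ᵀ (Matrix.toEuclideanLin (extGameMatrix Q) w.1))
      - β • (w.1 - w.2) - c • extLaplacian G d w.1 = 0 := congrArg Prod.fst hw
  rw [h2, smul_zero, sub_zero] at h1
  have hN' : (N : ℝ) ≠ 0 := by exact_mod_cast hN.ne'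
  have h3 := congrArg (average d) h1
  rw [map_sub, map_neg, average_selection_transpose, map_smul, average_laplacian, smul_zero,
    sub_zero, map_zero, neg_eq_zero, smul_eq_zero, or_iff_right (by simpa using hN')] at h3
  rw [h3, map_zero, neg_zero, zero_sub, neg_eq_zero, smul_eq_zero, or_iff_right hc.ne'] at h1
  have h4 := disagreement_eq_zero_of_laplacian G hG hN h1
  have h5 : average d w.1 = 0 := by
    rw [eq_consensus_add_disagreement w.1, h4, add_zero, extGameMatrix_consensusMap] at h3
    have := Matrix.eq_zero_of_mulVec_eq_zero hA (congrArg WithLp.ofLp h3)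
    exact WithLp.ofLp_injective 2 this
  have h6 := eq_zero_of_average_of_disagreement h5 h4
  exact Prod.ext h6 (by rw [← sub_eq_zero.1 h2, h6]; rfl)

/-- A LaSalle argument on eigenvectors. The dissipation of `x` plus that of `y` equals `σ` times a
nonnegative quantity, while each is nonpositive, so both vanish and the disagreements of the two
state components agree. -/
theorem closedLoop_isHurwitzMap {Q : Fin N → Matrix (Coord d) (Coord d) ℝ}
    (hA : (gameMatrix Q).det ≠ 0) {G : CommGraph N} (hG : G.graph.Connected) (hN : 2 ≤ N)
    {α β c : ℝ} (hα : 0 < α) (hβ : 0 < β) (hc : 0 < c)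
    {P : Matrix (Coord d ⊕ Coord d) (Coord d ⊕ Coord d) ℝ} (hP : P.PosDef)
    (hL : P * scaledM (gameMatrix Q) α β + (scaledM (gameMatrix Q) α β)ᵀ * P = -1)
    (hcL : c * G.lambda2 hN ≥ ‖extGameMatrix Q‖
      + (‖extGameMatrix Q‖ * (‖P‖ / √(N : ℝ) + 1 / 2)) ^ 2) :
    IsHurwitzMap (closedLoop Q G α β c) := by
  intro σ ω x y hσ hx hy
  have hN0 : 0 < N := by omega
  set B := lyapunovForm P α β with hB
  set T := closedLoop Q G α β c with hT
  have hdis := lyapunovForm_closedLoop_le hN hα hc hP.isHermitian hL hcL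
  have hle : ∀ w, B w (T w) ≤ 0 := fun w => (hdis w).trans (by
    have := mul_nonneg hβ.le (sq_nonneg ‖disagreement d w.1 - disagreement d w.2‖)
    nlinarith [sq_nonneg (√N * ‖averagedState d w‖ - ‖extGameMatrix Q‖ * (‖P‖ / √(N : ℝ) + 1 / 2)
          * ‖disagreement d w.1‖)])
  -- The `ω` terms cancel by symmetry of `B`.
  have hsum : B x (T x) + B y (T y) = σ * (B x x + B y y) := by
    rw [hx, hy, sub_eq_add_neg, ← neg_smul, hB, lyapunovForm_smul_add_smul,
      lyapunovForm_smul_add_smul, lyapunovForm_comm hP.isHermitian α β x y]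
    ring
  have hnn : 0 ≤ σ * (B x x + B y y) := mul_nonneg hσ
    (add_nonneg (lyapunovForm_self_nonneg hP hα hβ x) (lyapunovForm_self_nonneg hP hα hβ y))
  have hzero : ∀ w, B w (T w) = 0 → disagreement d w.1 = disagreement d w.2 ∧
      (disagreement d w.1 = 0 → averagedState d w = 0) := by
    intro w hw
    have h1 := hdis w
    change B w (T w) ≤ _ at h1
    rw [hw] at h1
    have h2 := sq_nonneg (√N * ‖averagedState d w‖
      - ‖extGameMatrix Q‖ * (‖P‖ / √(N : ℝ) + 1 / 2) * ‖disagreement d w.1‖)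
    have h3 := mul_nonneg hβ.le (sq_nonneg ‖disagreement d w.1 - disagreement d w.2‖)
    constructor
    · have h4 : β * ‖disagreement d w.1 - disagreement d w.2‖ ^ 2 = 0 := by linarith
      have h5 := (mul_eq_zero.1 h4).resolve_left hβ.ne'
      exact sub_eq_zero.1 (norm_eq_zero.1 ((pow_eq_zero_iff two_ne_zero).1 h5))
    · intro h
      have h4 : (√N * ‖averagedState d w‖
        - ‖extGameMatrix Q‖ * (‖P‖ / √(N : ℝ) + 1 / 2) * ‖disagreement d w.1‖) ^ 2 = 0 := by linarith
      rw [h, norm_zero, mul_zero, sub_zero, pow_eq_zero_iff two_ne_zero, mul_eq_zero] at h4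
      exact norm_eq_zero.1 (h4.resolve_left (Real.sqrt_pos.2 (by exact_mod_cast hN0)).ne')
  obtain ⟨hx1, hx2⟩ := hzero x (by linarith [hle x, hle y])
  obtain ⟨hy1, hy2⟩ := hzero y (by linarith [hle x, hle y])
  -- Equal disagreements freeze the disagreement of the second component, so the eigenvalue times
  -- that disagreement is zero.
  have hR : ∀ w : Stacked d × Stacked d, disagreement d w.1 = disagreement d w.2 →
      disagreement d (T w).2 = 0 := by
    intro w hw
    change disagreement d (α • (w.1 - w.2)) = 0
    rw [map_smul, map_sub, hw, sub_self, smul_zero]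
  have ex : σ • disagreement d x.2 - ω • disagreement d y.2 = 0 := by
    rw [← hR x hx1, hx]; simp
  have ey : ω • disagreement d x.2 + σ • disagreement d y.2 = 0 := by
    rw [← hR y hy1, hy]; simp
  -- For the eigenvalue `0` the disagreement is not determined this way, but then `x` and `y` lie in
  -- the kernel, which is trivial.
  rcases eq_or_ne (σ ^ 2 + ω ^ 2) 0 with h0 | h0
  · have hσ0 : σ = 0 := by nlinarith [sq_nonneg σ, sq_nonneg ω]
    have hω0 : ω = 0 := by nlinarith [sq_nonneg σ, sq_nonneg ω]
    rw [hσ0, hω0] at hx hy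
    exact ⟨eq_zero_of_closedLoop_eq_zero hA hG hN0 hα hc (by rw [← hT, hx]; simp),
      eq_zero_of_closedLoop_eq_zero hA hG hN0 hα hc (by rw [← hT, hy]; simp)⟩
  · have hx3 : disagreement d x.2 = 0 := by
      have : (σ ^ 2 + ω ^ 2) • disagreement d x.2
          = σ • (σ • disagreement d x.2 - ω • disagreement d y.2)
            + ω • (ω • disagreement d x.2 + σ • disagreement d y.2) := by module
      rw [ex, ey, smul_zero, smul_zero, add_zero] at this
      exact (smul_eq_zero.1 this).resolve_left h0
    have hy3 : disagreement d y.2 = 0 := by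
      have : (σ ^ 2 + ω ^ 2) • disagreement d y.2
          = σ • (ω • disagreement d x.2 + σ • disagreement d y.2)
            - ω • (σ • disagreement d x.2 - ω • disagreement d y.2) := by module
      rw [ex, ey, smul_zero, smul_zero, sub_zero] at this
      exact (smul_eq_zero.1 this).resolve_left h0
    exact ⟨eq_zero_of_averagedState (hx2 (hx1.trans hx3)) (hx1.trans hx3) hx3,
      eq_zero_of_averagedState (hy2 (hy1.trans hy3)) (hy1.trans hy3) hy3⟩

/-- An inverse Lipschitz pseudo-gradient has a nonsingular game matrix. -/
theorem det_gameMatrix_ne_zero {Q : Fin N → Matrix (Coord d) (Coord d) ℝ}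
    (hQ : ∀ i, (Q i)ᵀ = Q i) {l : Fin N → Coord d → ℝ} {e : Fin N → ℝ}
    (hinj : Function.Injective (pseudoGrad (quadCost Q l e))) : (gameMatrix Q).det ≠ 0 := by
  intro h
  obtain ⟨v, hv, h0⟩ := Matrix.exists_mulVec_eq_zero_iff.2 h
  refine hv ((WithLp.toLp_eq_zero 2).1 (hinj ?_))
  have h1 : Matrix.toEuclideanLin (gameMatrix Q) (WithLp.toLp 2 v) = 0 :=
    congrArg (WithLp.toLp 2) h0
  rw [pseudoGrad_quadCost hQ, pseudoGrad_quadCost hQ, h1, map_zero]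

theorem exists_pseudoGrad_eq_zero {Q : Fin N → Matrix (Coord d) (Coord d) ℝ}
    (hQ : ∀ i, (Q i)ᵀ = Q i) (l : Fin N → Coord d → ℝ) (e : Fin N → ℝ)
    (hA : (gameMatrix Q).det ≠ 0) : ∃ x, pseudoGrad (quadCost Q l e) x = 0 := by
  refine ⟨WithLp.toLp 2 (-((gameMatrix Q)⁻¹ *ᵥ (gameVector l).ofLp)), ?_⟩
  rw [pseudoGrad_quadCost hQ]
  apply WithLp.ofLp_injective 2
  simp [Matrix.mulVec_mulVec, Matrix.mul_nonsing_inv _ hA.isUnit]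

end ClosedLoop

end QuadGame

end

theorem mainTheorem8 {N : ℕ} (hN : 2 ≤ N) (d : Fin N → ℕ)
    (Q : Fin N → Matrix (QuadGame.Coord d) (QuadGame.Coord d) ℝ)
    (l : Fin N → QuadGame.Coord d → ℝ) (e : Fin N → ℝ)
    (hQ : ∀ i, (Q i)ᵀ = Q i)
    (hJ : QuadGame.RegularCosts (QuadGame.quadCost Q l e))
    (G : QuadGame.CommGraph N) (hG : G.graph.Connected)
    (LF R : NNReal) (μ : ℝ)
    (hLip : LipschitzWith LF (QuadGame.pseudoGrad (QuadGame.quadCost Q l e)))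
    (hInv : AntilipschitzWith R (QuadGame.pseudoGrad (QuadGame.quadCost Q l e)))
    (hHypo : QuadGame.Hypomonotone μ (QuadGame.pseudoGrad (QuadGame.quadCost Q l e)))
    (α₀ β₀ α β : ℝ) (hgains : QuadGame.AdmissibleGains (QuadGame.gameMatrix Q) α₀ β₀)
    (hα : α = α₀ / N) (hβ : β = β₀ / N) :
    (∀ x, QuadGame.IsNash (QuadGame.quadCost Q l e) x ↔
      QuadGame.pseudoGrad (QuadGame.quadCost Q l e) x = 0) ∧
    (∃ P : Matrix (QuadGame.Coord d ⊕ QuadGame.Coord d) (QuadGame.Coord d ⊕ QuadGame.Coord d) ℝ,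
      P.PosDef ∧ P * QuadGame.scaledM (QuadGame.gameMatrix Q) α β
        + (QuadGame.scaledM (QuadGame.gameMatrix Q) α β)ᵀ * P = -1) ∧
    (∀ P : Matrix (QuadGame.Coord d ⊕ QuadGame.Coord d) (QuadGame.Coord d ⊕ QuadGame.Coord d) ℝ,
      P.PosDef → P * QuadGame.scaledM (QuadGame.gameMatrix Q) α β
        + (QuadGame.scaledM (QuadGame.gameMatrix Q) α β)ᵀ * P = -1 →
      ∀ c : ℝ, 0 < c →
        c * G.lambda2 hN ≥ ‖QuadGame.extGameMatrix Q‖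
          + (‖QuadGame.extGameMatrix Q‖ * (‖P‖ / √(N : ℝ) + 1 / 2)) ^ 2 →
        QuadGame.GloballyAsymptoticallyStable
          (QuadGame.heavyAnchorField (QuadGame.quadCost Q l e) G.laplacian α β c)
          (QuadGame.consensualEquilibria (QuadGame.quadCost Q l e))) := by
  have hN0 : 0 < N := by omega
  have hA := QuadGame.det_gameMatrix_ne_zero hQ hInv.injective
  have hαpos : 0 < α := by rw [hα]; exact div_pos hgains.1 (by exact_mod_cast hN0)
  have hβpos : 0 < β := by rw [hβ]; exact div_pos hgains.2.1 (by exact_mod_cast hN0)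
  refine ⟨QuadGame.isNash_quadCost_iff hQ hJ, ?_, fun P hP hL c hc hcL => ?_⟩
  · rw [hα, hβ]
    exact (QuadGame.scaledM_isHurwitz hN0 hA hgains).exists_lyapunov
  · obtain ⟨x, hx⟩ := QuadGame.exists_pseudoGrad_eq_zero hQ l e hA
    -- Injectivity of `F` reduces the set to a point, so stability of an affine system about one
    -- equilibrium applies.
    have hset : QuadGame.consensualEquilibria (QuadGame.quadCost Q l e) =
        {(QuadGame.consensus x, QuadGame.consensus x)} := by
      ext w
      constructor
      · rintro ⟨y, hy, rfl⟩
        rw [hInv.injective (hy.trans hx.symm)]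
        rfl
      · rintro rfl
        exact ⟨x, hx, rfl⟩
    have hT := QuadGame.closedLoop_isHurwitzMap hA hG hN hαpos hβpos hc hP hL hcL
    rw [hset, funext (QuadGame.heavyAnchorField_quadCost hQ l e G α β c hx)]
    exact QuadGame.IsHurwitzMap.globallyAsymptoticallyStable
      (T := LinearMap.toContinuousLinearMap (QuadGame.closedLoop Q G α β c)) hT _
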